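/- Let $\eta_1,\dots,\eta_n$ be distinct points of the unit circle, let $q_1,\dots,q_n\in\mathbb R$, and put $R(z)=\prod_{j=1}^n(z-\eta_j)^{q_j}$ (real powers; only moduli matter, so $|R(z)|=\prod_j|z-\eta_j|^{q_j}$). For $p\ge 0$ and $D\in\mathbb R$, consider functions $f$ holomorphic in the unit disc $\mathbb D$ with $|f(0)|=1$ and $$|f(z)|\le\exp\frac{D}{(1-|z|^2)^p\,|R(z)|}\qquad(z\in\mathbb D).$$ Let $Z(f)$ denote the zeros of $f$ in $\mathbb D$, counted with multiplicity. (1) Case $p=0$. For every $\epsilon>0$ there is a constant $c=c(\epsilon,R)$ such that for all $D$ and all such $f$, $$\sum_{a\in Z(f)}(1-|a|)\,|R_\epsilon(a)|\le D\,c(\epsilon,R),\qquad R_\epsilon(z)=\prod_{j=1}^n(z-\eta_j)^{(q_j-1+\epsilon)_+},\quad x_+=\max(x,0).$$ (2) Case $p>0$. For each $j$ let $\tilde q_j=q_j$ if $q_j-1>-p/2$, and otherwise let $\tilde q_j$ be any chosen real number with $\tilde q_j>1-p/2$; put $\tilde R_0(z)=\prod_{j=1}^n(z-\eta_j)^{\tilde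 q_j-1}$. Then for every $\epsilon>0$ there is a constant $c$, depending only on $\epsilon$, $p$, $R$ (that is, on the $\eta_j$ and $q_j$) and the chosen $\tilde q_j$, such that for all $D$ and all such $f$, $$\sum_{a\in Z(f)}(1-|a|)^{1+p+\epsilon}\,|\tilde R_0(a)|\le D\,c.$$ In both cases the convergence of the series is part of the assertion. -/

import Mathlib

noncomputable section

/-- The generalised rational function `∏ⱼ (z - ηⱼ) ^ qⱼ` with real exponents `qⱼ`.
Only its modulus matters below; by `norm_ratProd` it does not depend on the branch. -/
def ratProd {n : ℕ} (η : Fin n → ℂ) (q : Fin n → ℝ) (z : ℂ) : ℂ :=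
  ∏ j, (z - η j) ^ ((q j : ℝ) : ℂ)

theorem norm_ratProd {n : ℕ} (η : Fin n → ℂ) (q : Fin n → ℝ) (z : ℂ) :
    ‖ratProd η q z‖ = ∏ j, ‖z - η j‖ ^ q j := by
  simp [ratProd, Complex.norm_cpow_real]

/-- `f` is holomorphic in the unit disc, `|f(0)| = 1`, and
`|f(z)| ≤ exp (D / ((1 - |z|²)^p |R(z)|))` in the disc, where `R = ∏ⱼ (z - ηⱼ) ^ qⱼ`. -/
structure HasGrowthBound {n : ℕ} (η : Fin n → ℂ) (q : Fin n → ℝ) (p D : ℝ) (f : ℂ → ℂ) :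
    Prop where
  holo : DifferentiableOn ℂ f (Metric.ball 0 1)
  norm_zero : ‖f 0‖ = 1
  bound : ∀ z ∈ Metric.ball (0 : ℂ) 1,
    ‖f z‖ ≤ Real.exp (D / ((1 - ‖z‖ ^ 2) ^ p * ‖ratProd η q z‖))

/-- The zeros of `f` in the open unit disc. -/
def zeroSet (f : ℂ → ℂ) : Set ℂ := {a | a ∈ Metric.ball (0 : ℂ) 1 ∧ f a = 0}

/-- `∑_{a ∈ Z(f)} w(a) ≤ B`, the zeros being counted with multiplicity: the series
converges and its sum is at most `B`. -/
def ZeroSumLE (f : ℂ → ℂ) (w : ℂ → ℝ) (B : ℝ) : Prop :=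
  Summable (fun a : zeroSet f => (analyticOrderNatAt f (a : ℂ) : ℝ) * w a) ∧
    ∑' a : zeroSet f, (analyticOrderNatAt f (a : ℂ) : ℝ) * w a ≤ B

/-- The exponents `q̃ⱼ`: `q̃ⱼ = qⱼ` if `qⱼ - 1 > -p/2`, and otherwise `q̃ⱼ` is any real
number larger than `1 - p/2`. -/
def IsModifiedExponent {n : ℕ} (p : ℝ) (q qt : Fin n → ℝ) : Prop :=
  ∀ j, (q j - 1 > -p / 2 → qt j = q j) ∧ (¬ q j - 1 > -p / 2 → qt j > 1 - p / 2)

end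

/-! In the sense of distributions `Δ log |f| = 2π ∑ mₐ δₐ` over the zeros `a` of `f`, with
multiplicities `mₐ`. Testing against a compactly supported `φ ≥ 0` turns the sum of `mₐ φ(a)` into
the integral of `log |f| Δφ`, and the growth bound controls `log |f|` from above. The test function
is `φ(z) = h(1 - |z|²) ∏ |z - ηⱼ| ^ αⱼ`, where `h(x)` is comparable to `x ^ (θ + 1)` away from a
cutoff at height `δ`. Thus `φ` is essentially the weight in the theorem.

An upper bound on `log |f|` is useful only where it is paired with a nonnegative density. Since `h'`
carries a factor `exp (κ x)` with `κ` large, `Δφ ≥ 0` whenever `1 - |z|² ≤ 1/2`; this needs `αⱼ ≥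
-θ/2` (`testLaplacian_nonneg`). In the central disc `Δφ` is only bounded below by `-K`. Adding `K`
there costs nothing: `|f(0)| = 1` and Jensen's formula make the integral of `log |f|` over that disc
nonnegative. Hence `log |f|` may be replaced by its positive part (`sum_zeros_le_integral`).

It remains to bound the integral of `M (Δφ + K 1)`, with `D M` the growth majorant, uniformly in
`δ`. The derivative of the cutoff factor is large, but its integral is at most `1`; everything else
is dominated by `(1 - |z|²) ^ (τ - 1) ∏ |z - ηⱼ| ^ (-σ)` with `τ > 0` and `σ < 1`, which is
integrable because the `ηⱼ` are distinct (`exists_integral_majorant_le`). Choosing `δ` after a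
finite set of zeros bounds all finite partial sums by one constant (`exists_zero_sum_bound`). The
two cases of the theorem are two choices of `θ`, `α`, `σ` and `τ`. -/

open Metric Set MeasureTheory Filter Topology

/-! ### Second line derivatives and Green's identity. -/

/-- `U` has continuous first and second line derivatives `U₁`, `U₂` in the direction `v` on `S`. -/
structure HasLineDerivTwiceOn (U U₁ U₂ : ℂ → ℝ) (v : ℂ) (S : Set ℂ) : Prop where
  cont : ContinuousOn U S
  cont₁ : ContinuousOn U₁ S
  cont₂ : ContinuousOn U₂ S
  deriv : ∀ z ∈ S, HasLineDerivAt ℝ U (U₁ z) z v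
  deriv₁ : ∀ z ∈ S, HasLineDerivAt ℝ U₁ (U₂ z) z v

namespace HasLineDerivTwiceOn

variable {U U₁ U₂ V V₁ V₂ : ℂ → ℝ} {v : ℂ} {S T : Set ℂ}

theorem mono (h : HasLineDerivTwiceOn U U₁ U₂ v S) (hT : T ⊆ S) :
    HasLineDerivTwiceOn U U₁ U₂ v T :=
  ⟨h.cont.mono hT, h.cont₁.mono hT, h.cont₂.mono hT, fun z hz => h.deriv z (hT hz),
    fun z hz => h.deriv₁ z (hT hz)⟩

theorem add (h : HasLineDerivTwiceOn U U₁ U₂ v S) (h' : HasLineDerivTwiceOn V V₁ V₂ v S) :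
    HasLineDerivTwiceOn (fun z => U z + V z) (fun z => U₁ z + V₁ z) (fun z => U₂ z + V₂ z) v S :=
  ⟨h.cont.add h'.cont, h.cont₁.add h'.cont₁, h.cont₂.add h'.cont₂,
    fun z hz => HasDerivAt.add (h.deriv z hz) (h'.deriv z hz),
    fun z hz => HasDerivAt.add (h.deriv₁ z hz) (h'.deriv₁ z hz)⟩

theorem const_mul (c : ℝ) (h : HasLineDerivTwiceOn U U₁ U₂ v S) :
    HasLineDerivTwiceOn (fun z => c * U z) (fun z => c * U₁ z) (fun z => c * U₂ z) v S :=
  ⟨continuousOn_const.mul h.cont, continuousOn_const.mul h.cont₁, continuousOn_const.mul h.cont₂,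
    fun z hz => HasDerivAt.const_mul c (h.deriv z hz),
    fun z hz => HasDerivAt.const_mul c (h.deriv₁ z hz)⟩

theorem sum {ι : Type*} (s : Finset ι) {F F₁ F₂ : ι → ℂ → ℝ}
    (h : ∀ i ∈ s, HasLineDerivTwiceOn (F i) (F₁ i) (F₂ i) v S) :
    HasLineDerivTwiceOn (fun z => ∑ i ∈ s, F i z) (fun z => ∑ i ∈ s, F₁ i z)
      (fun z => ∑ i ∈ s, F₂ i z) v S :=
  ⟨continuousOn_finsetSum s fun i hi => (h i hi).cont,
    continuousOn_finsetSum s fun i hi => (h i hi).cont₁,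
    continuousOn_finsetSum s fun i hi => (h i hi).cont₂,
    fun z hz => HasDerivAt.fun_sum fun i hi => (h i hi).deriv z hz,
    fun z hz => HasDerivAt.fun_sum fun i hi => (h i hi).deriv₁ z hz⟩

end HasLineDerivTwiceOn

theorem hasDerivAt_add_smul (z v : ℂ) : HasDerivAt (fun t : ℝ => z + t • v) v 0 := by
  simpa using ((hasDerivAt_id (0 : ℝ)).smul_const v).const_add z

theorem hasLineDerivAt_re_comp {k : ℂ → ℂ} {k' z : ℂ} (v : ℂ) (hk : HasDerivAt k k' z) :
    HasLineDerivAt ℝ (fun z => (k z).re) (v * k').re z v := by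
  have h1 : HasDerivAt (fun t : ℝ => k (z + t • v)) (v • k') 0 :=
    HasDerivAt.scomp (𝕜 := ℝ) (𝕜' := ℂ) (0 : ℝ) (g₁ := k) (by simpa using hk)
      (hasDerivAt_add_smul z v)
  exact (Complex.reCLM.hasFDerivAt.comp_hasDerivAt (0 : ℝ) h1)

theorem hasLineDerivAt_log_norm {k : ℂ → ℂ} {k' z : ℂ} (v : ℂ) (hk : HasDerivAt k k' z)
    (h0 : k z ≠ 0) : HasLineDerivAt ℝ (fun z => Real.log ‖k z‖) (v * (k' / k z)).re z v := by
  have h1 : HasDerivAt (fun t : ℝ => k (z + t • v)) (v • k') 0 :=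
    HasDerivAt.scomp (𝕜 := ℝ) (𝕜' := ℂ) (0 : ℝ) (g₁ := k) (by simpa using hk)
      (hasDerivAt_add_smul z v)
  -- The squared norm is smooth, so `log ‖k‖` is differentiated as half the logarithm of `‖k‖²`.
  have h2 : HasDerivAt (fun t : ℝ => (1 / 2) * Real.log (‖k (z + t • v)‖ ^ 2))
      ((1 / 2) * ((2 * inner ℝ (k z) (v • k')) / ‖k z‖ ^ 2)) 0 := by
    have h3 := h1.norm_sq
    simp only [zero_smul, add_zero] at h3
    refine HasDerivAt.const_mul _ ?_
    have := h3.log (by simpa using h0)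
    simpa using this
  refine (h2.congr_deriv ?_).congr_of_eventuallyEq (Eventually.of_forall fun t => ?_)
  · rw [← Complex.normSq_eq_norm_sq, Complex.inner]
    simp only [smul_eq_mul, Complex.mul_re, Complex.mul_im, Complex.conj_re, Complex.conj_im,
      Complex.div_re, Complex.div_im]
    have : Complex.normSq (k z) ≠ 0 := by simpa using h0
    field_simp
    ring
  · simp [Real.log_pow]

/-- The second derivative is the real part of `v²` times a complex number, so the directions `1` and
`I` cancel: this is the harmonicity of `log ‖k‖`. -/
theorem hasLineDerivTwiceOn_log_norm {k : ℂ → ℂ} {S : Set ℂ} (hk : ∀ z ∈ S, AnalyticAt ℂ k z)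
    (h0 : ∀ z ∈ S, k z ≠ 0) (v : ℂ) :
    HasLineDerivTwiceOn (fun z => Real.log ‖k z‖) (fun z => (v * logDeriv k z).re)
      (fun z => (v * (v * deriv (logDeriv k) z)).re) v S := by
  have hl : ∀ z ∈ S, AnalyticAt ℂ (logDeriv k) z := fun z hz =>
    ((hk z hz).deriv.div (hk z hz) (h0 z hz))
  refine ⟨fun z hz => ?_, fun z hz => ?_, fun z hz => ?_, fun z hz => ?_, fun z hz => ?_⟩
  · exact (((hk z hz).continuousAt.norm).log (by simpa using h0 z hz)).continuousWithinAt
  · exact (Complex.continuous_re.continuousAt.comp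
      (continuousAt_const.mul (hl z hz).continuousAt)).continuousWithinAt
  · exact (Complex.continuous_re.continuousAt.comp
      (continuousAt_const.mul (continuousAt_const.mul
        (hl z hz).deriv.continuousAt))).continuousWithinAt
  · exact hasLineDerivAt_log_norm v (hk z hz).differentiableAt.hasDerivAt (h0 z hz)
  · exact hasLineDerivAt_re_comp v ((hl z hz).differentiableAt.hasDerivAt.const_mul v)

theorem hasLineDerivAt_norm_sub_sq (a z v : ℂ) :
    HasLineDerivAt ℝ (fun z => ‖z - a‖ ^ 2) (2 * inner ℝ (z - a) v) z v := by
  have := ((hasDerivAt_add_smul z v).sub_const a).norm_sq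
  simpa [HasLineDerivAt] using this

theorem hasLineDerivAt_inner (a z v : ℂ) :
    HasLineDerivAt ℝ (fun z => inner ℝ (z - a) v) (‖v‖ ^ 2) z v := by
  have := ((hasDerivAt_add_smul z v).sub_const a).inner ℝ (hasDerivAt_const (0 : ℝ) v)
  simpa [HasLineDerivAt] using this

/-- The regularised logarithm `½ log (|z - a|² + s²)`. -/
theorem hasLineDerivTwiceOn_log_norm_sq_add (a : ℂ) {s : ℝ} (hs : 0 < s) (v : ℂ) (S : Set ℂ) :
    HasLineDerivTwiceOn (fun z => 1 / 2 * Real.log (‖z - a‖ ^ 2 + s ^ 2))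
      (fun z => inner ℝ (z - a) v / (‖z - a‖ ^ 2 + s ^ 2))
      (fun z => (‖v‖ ^ 2 * (‖z - a‖ ^ 2 + s ^ 2) - 2 * inner ℝ (z - a) v ^ 2) /
        (‖z - a‖ ^ 2 + s ^ 2) ^ 2) v S := by
  have hp : ∀ z : ℂ, ‖z - a‖ ^ 2 + s ^ 2 ≠ 0 := fun z => by positivity
  refine ⟨Continuous.continuousOn ?_, Continuous.continuousOn ?_, Continuous.continuousOn ?_,
    fun z _ => ?_, fun z _ => ?_⟩
  · exact continuous_const.mul (Continuous.log (by fun_prop) hp)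
  · exact Continuous.div (by fun_prop) (by fun_prop) hp
  · exact Continuous.div (by fun_prop) (by fun_prop) fun z => pow_ne_zero 2 (hp z)
  · have h := (((hasLineDerivAt_norm_sub_sq a z v).add_const (s ^ 2)).log
      (by simpa using hp z)).const_mul (1 / 2)
    refine HasDerivAt.congr_deriv h ?_
    simp only [zero_smul, add_zero]
    field_simp
  · have h := HasDerivAt.fun_div (hasLineDerivAt_inner a z v)
      ((hasLineDerivAt_norm_sub_sq a z v).add_const (s ^ 2)) (by simpa using hp z)
    refine HasDerivAt.congr_deriv h ?_
    simp only [zero_smul, add_zero]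
    congr 1
    ring

/-- The second derivative of `χ (1 - |z|²) exp L`. -/
theorem HasLineDerivTwiceOn.comp_mul_exp {L L₁ L₂ : ℂ → ℝ} {v : ℂ} {S : Set ℂ}
    (hL : HasLineDerivTwiceOn L L₁ L₂ v S) {χ χ₁ χ₂ : ℝ → ℝ} (h1 : ∀ x, HasDerivAt χ (χ₁ x) x)
    (h2 : ∀ x, HasDerivAt χ₁ (χ₂ x) x) (hc : Continuous χ₂) :
    HasLineDerivTwiceOn (fun z => χ (1 - ‖z‖ ^ 2) * Real.exp (L z))
      (fun z => (-2 * χ₁ (1 - ‖z‖ ^ 2) * inner ℝ z v + χ (1 - ‖z‖ ^ 2) * L₁ z) * Real.exp (L z))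
      (fun z => (4 * χ₂ (1 - ‖z‖ ^ 2) * inner ℝ z v ^ 2 - 2 * χ₁ (1 - ‖z‖ ^ 2) * ‖v‖ ^ 2
        - 4 * χ₁ (1 - ‖z‖ ^ 2) * inner ℝ z v * L₁ z
        + χ (1 - ‖z‖ ^ 2) * (L₁ z ^ 2 + L₂ z)) * Real.exp (L z)) v S := by
  have hχ : Continuous χ := continuous_iff_continuousAt.2 fun x => (h1 x).continuousAt
  have hχ₁ : Continuous χ₁ := continuous_iff_continuousAt.2 fun x => (h2 x).continuousAt
  have := hL.cont; have := hL.cont₁; have := hL.cont₂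
  have hw : ∀ z : ℂ, HasLineDerivAt ℝ (fun z => 1 - ‖z‖ ^ 2) (-(2 * inner ℝ z v)) z v := fun z => by
    have := (hasLineDerivAt_norm_sub_sq 0 z v).const_sub 1
    simpa [HasLineDerivAt] using this
  have hi : ∀ z : ℂ, HasLineDerivAt ℝ (fun z => inner ℝ z v) (‖v‖ ^ 2) z v := fun z => by
    simpa using hasLineDerivAt_inner 0 z v
  have hcomp : ∀ {ψ : ℝ → ℝ} {ψ' : ℝ} (z : ℂ), HasDerivAt ψ ψ' (1 - ‖z‖ ^ 2) →
      HasLineDerivAt ℝ (fun z => ψ (1 - ‖z‖ ^ 2)) (ψ' * -(2 * inner ℝ z v)) z v := fun z h =>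
    HasDerivAt.comp (0 : ℝ) (h₂ := _) (by simpa using h) (hw z)
  refine ⟨by fun_prop, by fun_prop, by fun_prop, fun z hz => ?_, fun z hz => ?_⟩
  · refine HasDerivAt.congr_deriv (HasDerivAt.fun_mul (hcomp z (h1 _)) (hL.deriv z hz).exp) ?_
    simp only [zero_smul, add_zero]
    ring
  · refine HasDerivAt.congr_deriv (HasDerivAt.fun_mul (HasDerivAt.fun_add
      (HasDerivAt.fun_mul (HasDerivAt.const_mul (-2) (hcomp z (h2 _))) (hi z))
      (HasDerivAt.fun_mul (hcomp z (h1 _)) (hL.deriv₁ z hz))) (hL.deriv z hz).exp) ?_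
    simp only [zero_smul, add_zero]
    ring

theorem ContinuousOn.continuous_of_eq_zero_off {k : ℂ → ℝ} {S K : Set ℂ} (hk : ContinuousOn k S)
    (hS : IsOpen S) (hK : IsClosed K) (hKS : K ⊆ S) (h0 : ∀ z ∉ K, k z = 0) : Continuous k := by
  refine hk.continuous_of_tsupport_subset hS (subset_trans ?_ hKS)
  exact closure_minimal (fun z hz => by by_contra h; exact hz (h0 z h)) hK

theorem integral_lineDeriv_eq_zero {F F' : ℂ → ℝ} {v : ℂ} (hF : Integrable F)
    (hF' : Integrable F') (h : ∀ z, HasLineDerivAt ℝ F (F' z) z v) : ∫ z, F' z = 0 := by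
  have := integral_bilinear_hasLineDerivAt_right_eq_neg_left_of_integrable
    (f := fun _ : ℂ => (1 : ℝ)) (f' := fun _ => (0 : ℝ)) (g := F) (g' := F') (v := v)
    (B := ContinuousLinearMap.mul ℝ ℝ) (μ := volume) (by simp)
    (by simpa using hF') (by simpa using hF)
    (fun z _ => by simpa [HasLineDerivAt] using hasDerivAt_const (0 : ℝ) (1 : ℝ)) (fun z _ => h z)
  simpa using this

/-- Green's second identity in one direction: `U φ₁ - φ U₁` has compact support and derivative `U φ₂
- φ U₂`, whose integral is therefore zero. -/
theorem integral_mul_secondDeriv {U U₁ U₂ φ φ₁ φ₂ : ℂ → ℝ} {v : ℂ} {S K : Set ℂ}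
    (hU : HasLineDerivTwiceOn U U₁ U₂ v S) (hφ : HasLineDerivTwiceOn φ φ₁ φ₂ v S)
    (hS : IsOpen S) (hK : IsCompact K) (hKS : K ⊆ S) (h0 : ∀ z ∉ K, φ z = 0)
    (h1 : ∀ z ∉ K, φ₁ z = 0) (h2 : ∀ z ∉ K, φ₂ z = 0) :
    ∫ z, U z * φ₂ z = ∫ z, φ z * U₂ z := by
  have key : ∀ {k : ℂ → ℝ}, ContinuousOn k S → (∀ z ∉ K, k z = 0) → Integrable k := by
    intro k hk hk0
    refine (hk.continuous_of_eq_zero_off hS hK.isClosed hKS hk0).integrable_of_hasCompactSupport ?_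
    exact HasCompactSupport.intro hK hk0
  have i1 : Integrable fun z => U z * φ₂ z :=
    key (hU.cont.mul hφ.cont₂) fun z hz => by simp [h2 z hz]
  have i2 : Integrable fun z => φ z * U₂ z :=
    key (hφ.cont.mul hU.cont₂) fun z hz => by simp [h0 z hz]
  have i3 : Integrable fun z => U z * φ₁ z - φ z * U₁ z :=
    key ((hU.cont.mul hφ.cont₁).sub (hφ.cont.mul hU.cont₁)) fun z hz => by simp [h0 z hz, h1 z hz]
  have := integral_lineDeriv_eq_zero (v := v) i3 (i1.sub i2) (fun z => by
    by_cases hz : z ∈ K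
    · have hz := hKS hz
      refine HasDerivAt.congr_deriv (HasDerivAt.fun_sub
        (HasDerivAt.fun_mul (hU.deriv z hz) (hφ.deriv₁ z hz))
        (HasDerivAt.fun_mul (hφ.deriv z hz) (hU.deriv₁ z hz))) ?_
      simp only [zero_smul, add_zero, Pi.sub_apply]
      ring
    · have : (fun t : ℝ => U (z + t • v) * φ₁ (z + t • v) - φ (z + t • v) * U₁ (z + t • v))
          =ᶠ[𝓝 0] fun _ => 0 := by
        have hc : Tendsto (fun t : ℝ => z + t • v) (𝓝 0) (𝓝 z) := by
          have : Continuous fun t : ℝ => z + t • v := by fun_prop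
          simpa using this.tendsto 0
        filter_upwards [hc.eventually (hK.isClosed.isOpen_compl.mem_nhds hz)] with t ht
        rw [h0 _ ht, h1 _ ht]; ring
      refine ((hasDerivAt_const (0 : ℝ) (0 : ℝ)).congr_of_eventuallyEq this).congr_deriv ?_
      simp [h0 z hz, h2 z hz])
  simp only [Pi.sub_apply] at this
  rw [integral_sub i1 i2] at this
  linarith

/-! ### Factoring out zeros, and nonnegative means of `log |f|`. -/

theorem exists_zero_factorization {f : ℂ → ℂ} {r : ℝ} (hr : 0 < r)
    (hf : AnalyticOnNhd ℂ f (closedBall 0 r)) (h0 : f 0 ≠ 0) :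
    ∃ (Z : Finset ℂ) (g : ℂ → ℂ), (∀ a ∈ closedBall 0 r, f a = 0 → a ∈ Z) ∧
      AnalyticOnNhd ℂ g (closedBall 0 r) ∧ (∀ z ∈ closedBall 0 r, g z ≠ 0) ∧
      ∀ z ∈ ball 0 r, f z = (∏ a ∈ Z, (z - a) ^ analyticOrderNatAt f a) * g z := by
  have hord : ∀ z ∈ closedBall (0 : ℂ) r, analyticOrderAt f z ≠ ⊤ := by
    intro z hz h
    rw [analyticOrderAt_eq_top] at h
    exact h0 (hf.eqOn_zero_of_preconnected_of_eventuallyEq_zero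
      (convex_closedBall (0 : ℂ) r).isPreconnected hz h (mem_closedBall_self hr.le))
  have hmer : ∀ z ∈ closedBall (0 : ℂ) r,
      meromorphicOrderAt f z = ((analyticOrderNatAt f z : ℤ) : WithTop ℤ) := by
    intro z hz
    rw [(hf z hz).meromorphicOrderAt_eq, ← Nat.cast_analyticOrderNatAt (hord z hz)]
    rfl
  have hdiv : ∀ z ∈ closedBall (0 : ℂ) r,
      MeromorphicOn.divisor f (closedBall 0 r) z = analyticOrderNatAt f z := by
    intro z hz
    rw [MeromorphicOn.divisor_apply hf.meromorphicOn hz, hmer z hz]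
    rfl
  have hfin : (MeromorphicOn.divisor f (closedBall 0 r)).support.Finite :=
    (MeromorphicOn.divisor f (closedBall 0 r)).finiteSupport (isCompact_closedBall 0 r)
  obtain ⟨g, hg, hg0, hfg⟩ := hf.meromorphicOn.extract_zeros_poles
    (fun u => by rw [hmer u u.2]; exact WithTop.coe_ne_top) hfin
  have hsub : ∀ a ∈ hfin.toFinset, a ∈ closedBall (0 : ℂ) r := fun a ha =>
    (MeromorphicOn.divisor f (closedBall 0 r)).supportWithinDomain (hfin.mem_toFinset.1 ha)
  have hP : (∏ᶠ u : ℂ, (fun x : ℂ => x - u) ^ (MeromorphicOn.divisor f (closedBall 0 r)) u)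
      = fun z => ∏ a ∈ hfin.toFinset, (z - a) ^ analyticOrderNatAt f a := by
    rw [finprod_eq_prod_of_mulSupport_subset (s := hfin.toFinset)]
    · ext z
      rw [Finset.prod_apply]
      refine Finset.prod_congr rfl fun a ha => ?_
      rw [Pi.pow_apply, hdiv a (hsub a ha), zpow_natCast]
    · intro a ha
      simp only [Finite.coe_toFinset, Function.mem_support]
      intro h
      simp [h] at ha
  rw [hP] at hfg
  refine ⟨hfin.toFinset, g, fun a ha hfa => ?_, hg, fun z hz => hg0 ⟨z, hz⟩, fun z hz => ?_⟩
  · rw [hfin.mem_toFinset, Function.mem_support, hdiv a ha]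
    have : analyticOrderAt f a ≠ 0 := (hf a ha).analyticOrderAt_ne_zero.2 hfa
    intro h
    apply this
    rw [← Nat.cast_analyticOrderNatAt (hord a ha)]
    exact_mod_cast h
  · have hzc := ball_subset_closedBall hz
    -- The factorization is known only off a discrete set; continuity of both sides extends it to
    -- every point of the open disc.
    have h1 : f =ᶠ[𝓝[≠] z] fun z => (∏ a ∈ hfin.toFinset, (z - a) ^ analyticOrderNatAt f a) * g z := by
      have h2 : ∀ᶠ x in 𝓝[≠] z, x ∈ closedBall (0 : ℂ) r :=
        nhdsWithin_le_nhds (mem_of_superset (isOpen_ball.mem_nhds hz) ball_subset_closedBall)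
      have h3 := mem_codiscreteWithin_iff_forall_mem_nhdsNE.1 hfg z hzc
      filter_upwards [h2, h3] with x hx hx'
      rcases hx' with hx' | hx'
      · exact hx'
      · exact absurd hx hx'
    have c2 : ContinuousAt (fun z => (∏ a ∈ hfin.toFinset, (z - a) ^ analyticOrderNatAt f a) * g z) z :=
      (Continuous.continuousAt (by fun_prop)).mul (hg z hzc).continuousAt
    exact tendsto_nhds_unique_of_eventuallyEq
      ((hf z hzc).continuousAt.tendsto.mono_left nhdsWithin_le_nhds)
      (c2.tendsto.mono_left nhdsWithin_le_nhds) h1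

/-- In polar coordinates the area integral is an integral of circle averages with the positive
weight `2π ρ`. -/
theorem setIntegral_ball_nonneg {U : ℂ → ℝ} {R : ℝ} (hU : ContinuousOn U (closedBall 0 R))
    (h : ∀ᵐ ρ : ℝ, ρ ∈ Ioo 0 R → 0 ≤ Real.circleAverage U 0 ρ) :
    0 ≤ ∫ z in ball 0 R, U z := by
  rw [← integral_indicator measurableSet_ball, ← Complex.integral_comp_polarCoord_symm,
    polarCoord_target]
  set G : ℝ × ℝ → ℝ := fun p => p.1 * U (p.1 * (Real.cos p.2 + Real.sin p.2 * Complex.I)) with hG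
  have hn : ∀ p : ℝ × ℝ, ‖(p.1 : ℂ) * (Real.cos p.2 + Real.sin p.2 * Complex.I)‖ = |p.1| := by
    intro p
    rw [norm_mul, Complex.norm_real, Complex.ofReal_cos, Complex.ofReal_sin,
      Complex.norm_cos_add_sin_mul_I]
    simp
  have e1 : ∫ p in Ioi (0 : ℝ) ×ˢ Ioo (-Real.pi) Real.pi,
      p.1 • (ball (0 : ℂ) R).indicator U (Complex.polarCoord.symm p) =
      ∫ p in Ioo (0 : ℝ) R ×ˢ Ioo (-Real.pi) Real.pi, G p := by
    rw [← integral_indicator (measurableSet_Ioi.prod measurableSet_Ioo),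
      ← integral_indicator (measurableSet_Ioo.prod measurableSet_Ioo)]
    congr 1
    ext p
    have hm : (Complex.polarCoord.symm p ∈ ball (0 : ℂ) R) ↔ |p.1| < R := by
      rw [Complex.polarCoord_symm_apply, mem_ball_zero_iff, hn p]
    by_cases h1 : p.1 ∈ Ioi (0 : ℝ)
    · by_cases h2 : p.2 ∈ Ioo (-Real.pi) Real.pi
      · rw [indicator_of_mem (show p ∈ Ioi (0 : ℝ) ×ˢ Ioo (-Real.pi) Real.pi from ⟨h1, h2⟩)]
        have h3 : |p.1| = p.1 := abs_of_pos h1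
        by_cases h4 : p.1 < R
        · rw [indicator_of_mem (hm.2 (by rwa [h3])),
            indicator_of_mem (show p ∈ Ioo (0 : ℝ) R ×ˢ Ioo (-Real.pi) Real.pi from ⟨⟨h1, h4⟩, h2⟩),
            Complex.polarCoord_symm_apply, smul_eq_mul]
        · rw [indicator_of_notMem (fun h => h4 (by rw [← h3]; exact hm.1 h)),
            indicator_of_notMem (fun h => h4 h.1.2), smul_zero]
      · rw [indicator_of_notMem (fun h => h2 h.2), indicator_of_notMem (fun h => h2 h.2)]
    · rw [indicator_of_notMem (fun h => h1 h.1), indicator_of_notMem (fun h => h1 h.1.1)]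
  rw [e1]
  have hGc : ContinuousOn G (Icc 0 R ×ˢ Icc (-Real.pi) Real.pi) := by
    refine continuous_fst.continuousOn.mul (hU.comp (Continuous.continuousOn ?_) fun p hp => ?_)
    · fun_prop
    · rw [mem_closedBall_zero_iff, hn p, abs_of_nonneg hp.1.1]
      exact hp.1.2
  have hGi : IntegrableOn G (Ioo 0 R ×ˢ Ioo (-Real.pi) Real.pi) :=
    (hGc.integrableOn_compact (isCompact_Icc.prod isCompact_Icc)).mono_set
      (prod_mono Ioo_subset_Icc_self Ioo_subset_Icc_self)
  rw [Measure.volume_eq_prod] at hGi ⊢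
  rw [setIntegral_prod _ hGi]
  refine setIntegral_nonneg_ae measurableSet_Ioo ?_
  filter_upwards [h] with ρ hρ hρ'
  have h1 := hρ hρ'
  simp only [hG]
  rw [integral_const_mul]
  refine mul_nonneg hρ'.1.le ?_
  rw [Real.circleAverage_eq_integral_add (-Real.pi),
    intervalIntegral.integral_comp_add_right (fun θ => U (circleMap 0 ρ θ)), smul_eq_mul] at h1
  have h2 := nonneg_of_mul_nonneg_right h1 (by positivity)
  rw [show 0 + -Real.pi = -Real.pi by ring, show 2 * Real.pi + -Real.pi = Real.pi by ring,
    intervalIntegral.integral_of_le (by linarith [Real.pi_pos]), integral_Ioc_eq_integral_Ioo] at h2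
  simpa [circleMap, Complex.exp_mul_I] using h2

/-- Jensen's formula: with `log ‖f 0‖ = 0` the average is a sum of multiplicities times `log (R /
|u|)` over zeros in the disc of radius `R`. -/
theorem circleAverage_log_norm_nonneg {f : ℂ → ℂ} {R : ℝ} (hR : 0 < R)
    (hf : AnalyticOnNhd ℂ f (closedBall 0 R)) (h0 : ‖f 0‖ = 1) :
    0 ≤ Real.circleAverage (fun z => Real.log ‖f z‖) 0 R := by
  have hR' : |R| = R := abs_of_pos hR
  have hf' : AnalyticOnNhd ℂ f (closedBall 0 |R|) := by rwa [hR']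
  rw [AnalyticOnNhd.circleAverage_log_norm hR.ne' hf' (by rw [← norm_ne_zero_iff, h0]; simp),
    h0, Real.log_one, add_zero]
  refine finsum_nonneg fun u => ?_
  by_cases hu : u ∈ closedBall (0 : ℂ) |R|
  · refine mul_nonneg (by exact_mod_cast MeromorphicOn.AnalyticOnNhd.divisor_nonneg hf' u) ?_
    -- At `u = 0` the factor is `Real.log (R * 0⁻¹) = Real.log 0 = 0` by the default values.
    rcases eq_or_ne u 0 with rfl | hu0
    · simp
    · refine Real.log_nonneg ?_
      rw [hR', mem_closedBall_zero_iff] at hu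
      rw [zero_sub, norm_neg, ← div_eq_mul_inv, one_le_div (by positivity)]
      exact hu
  · rw [Function.locallyFinsuppWithin.apply_eq_zero_of_notMem _ hu]
    simp

/-! ### The regularised logarithm and its Laplacian. -/

/-- The kernel `2 / (1 + |ζ|²)²` is integrable. -/
theorem integrable_fubiniStudy : Integrable fun ζ : ℂ => 2 / (1 + ‖ζ‖ ^ 2) ^ 2 := by
  have := (integrable_rpow_neg_one_add_norm_sq (E := ℂ) (μ := volume) (r := 4)
    (by rw [Complex.finrank_real_complex]; norm_num)).const_mul 2
  refine this.congr (Eventually.of_forall fun ζ => ?_)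
  have : (0 : ℝ) < 1 + ‖ζ‖ ^ 2 := by positivity
  simp only
  rw [show (-4 / 2 : ℝ) = -(2 : ℕ) by norm_num, Real.rpow_neg this.le, Real.rpow_natCast,
    div_eq_mul_inv]

/-- The value is `2π`, the mass of `Δ log |z|`; positivity suffices because the constant is divided
out at the end. -/
theorem integral_fubiniStudy_pos : 0 < ∫ ζ : ℂ, 2 / (1 + ‖ζ‖ ^ 2) ^ 2 := by
  refine (integral_pos_iff_support_of_nonneg (fun ζ => by positivity) integrable_fubiniStudy).2 ?_
  have : Function.support (fun ζ : ℂ => 2 / (1 + ‖ζ‖ ^ 2) ^ 2) = univ := by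
    ext ζ
    simp only [Function.mem_support, mem_univ, iff_true]
    positivity
  rw [this]
  exact isOpen_univ.measure_pos _ univ_nonempty

/-- The substitution `z = s ζ + a` moves `s` from the kernel into the argument of `φ`; dominated
convergence with the fixed kernel then concentrates the mass at `a`. -/
theorem tendsto_integral_mul_kernel {φ : ℂ → ℝ} (hφ : Continuous φ) {C : ℝ} (hC : ∀ z, |φ z| ≤ C)
    (a : ℂ) {s : ℕ → ℝ} (hs : ∀ n, 0 < s n) (hs0 : Tendsto s atTop (𝓝 0)) :
    Tendsto (fun n => ∫ z, φ z * (2 * s n ^ 2 / (‖z - a‖ ^ 2 + s n ^ 2) ^ 2)) atTop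
      (𝓝 ((∫ ζ : ℂ, 2 / (1 + ‖ζ‖ ^ 2) ^ 2) * φ a)) := by
  have hcv : ∀ n, ∫ z, φ z * (2 * s n ^ 2 / (‖z - a‖ ^ 2 + s n ^ 2) ^ 2) =
      ∫ ζ : ℂ, φ (s n • ζ + a) * (2 / (1 + ‖ζ‖ ^ 2) ^ 2) := by
    intro n
    have hn := hs n
    rw [← integral_add_right_eq_self _ a]
    have h := Measure.integral_comp_smul (volume : Measure ℂ)
      (fun z => φ (z + a) * (2 * s n ^ 2 / (‖z + a - a‖ ^ 2 + s n ^ 2) ^ 2)) (s n)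
    rw [Complex.finrank_real_complex] at h
    have h2 : ∫ z : ℂ, φ (z + a) * (2 * s n ^ 2 / (‖z + a - a‖ ^ 2 + s n ^ 2) ^ 2) = s n ^ 2 *
        ∫ ζ : ℂ, φ (s n • ζ + a) * (2 * s n ^ 2 / (‖s n • ζ + a - a‖ ^ 2 + s n ^ 2) ^ 2) := by
      rw [h, smul_eq_mul, abs_of_pos (by positivity), ← mul_assoc, mul_inv_cancel₀ (by positivity),
        one_mul]
    rw [h2, ← integral_const_mul]
    congr 1
    ext ζ
    rw [add_sub_cancel_right, norm_smul, Real.norm_eq_abs, abs_of_pos hn]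
    have : (0 : ℝ) < 1 + ‖ζ‖ ^ 2 := by positivity
    have h3 : (s n * ‖ζ‖) ^ 2 + s n ^ 2 = s n ^ 2 * (1 + ‖ζ‖ ^ 2) := by ring
    rw [h3]
    field_simp
  simp_rw [hcv]
  rw [mul_comm, ← integral_const_mul]
  refine tendsto_integral_of_dominated_convergence (fun ζ => C * (2 / (1 + ‖ζ‖ ^ 2) ^ 2))
    (fun n => ?_) (integrable_fubiniStudy.const_mul C) (fun n => Eventually.of_forall fun ζ => ?_)
    (Eventually.of_forall fun ζ => ?_)
  · refine Continuous.aestronglyMeasurable ?_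
    refine (hφ.comp (by fun_prop)).mul (Continuous.div (by fun_prop) (by fun_prop) fun ζ => ?_)
    positivity
  · rw [norm_mul, Real.norm_eq_abs, Real.norm_eq_abs, abs_of_nonneg (a := 2 / _) (by positivity)]
    gcongr
    exact hC _
  · refine Tendsto.mul_const _ ?_
    have : Continuous fun t : ℝ => φ (t • ζ + a) := hφ.comp (by fun_prop)
    have h := (this.tendsto 0).comp hs0
    simp only [zero_smul, zero_add] at h
    exact h

/-- `∑ mₐ ½ log (|z - a|² + s²) + log |g|`, a smooth majorant of `log |∏ (z - a) ^ mₐ g|`. -/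
noncomputable def regLog (Z : Finset ℂ) (m : ℂ → ℕ) (g : ℂ → ℂ) (s : ℝ) (z : ℂ) : ℝ :=
  ∑ a ∈ Z, m a * (1 / 2 * Real.log (‖z - a‖ ^ 2 + s ^ 2)) + Real.log ‖g z‖

section regLog

variable {Z : Finset ℂ} {m : ℂ → ℕ} {g : ℂ → ℂ}

theorem continuousOn_regLog {S : Set ℂ} (hg : ∀ z ∈ S, AnalyticAt ℂ g z) (hg0 : ∀ z ∈ S, g z ≠ 0)
    {s : ℝ} (hs : 0 < s) : ContinuousOn (regLog Z m g s) S := by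
  refine ContinuousOn.add (continuousOn_finsetSum _ fun a _ => ?_) ?_
  · exact continuousOn_const.mul (hasLineDerivTwiceOn_log_norm_sq_add a hs 1 S).cont
  · exact (hasLineDerivTwiceOn_log_norm hg hg0 1).cont

theorem log_norm_prod_mul {z : ℂ} (hz : z ∉ Z) (hg : g z ≠ 0) :
    Real.log ‖(∏ a ∈ Z, (z - a) ^ m a) * g z‖ =
      ∑ a ∈ Z, m a * (1 / 2 * Real.log (‖z - a‖ ^ 2)) + Real.log ‖g z‖ := by
  have h1 : ∀ a ∈ Z, ‖z - a‖ ^ m a ≠ 0 := fun a ha =>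
    pow_ne_zero _ (norm_ne_zero_iff.2 (sub_ne_zero.2 fun h => hz (h ▸ ha)))
  rw [norm_mul, norm_prod]
  simp_rw [norm_pow]
  rw [Real.log_mul (Finset.prod_ne_zero_iff.2 h1) (norm_ne_zero_iff.2 hg), Real.log_prod h1]
  congr 1
  refine Finset.sum_congr rfl fun a _ => ?_
  rw [Real.log_pow, Real.log_pow]
  push_cast
  ring

theorem log_norm_le_regLog {z : ℂ} (hz : z ∉ Z) (hg : g z ≠ 0) (s : ℝ) :
    Real.log ‖(∏ a ∈ Z, (z - a) ^ m a) * g z‖ ≤ regLog Z m g s z := by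
  rw [log_norm_prod_mul hz hg, regLog]
  gcongr with a ha
  · have : 0 < ‖z - a‖ := norm_pos_iff.2 (sub_ne_zero.2 fun h => hz (h ▸ ha))
    positivity
  · nlinarith [sq_nonneg s]

/-- Makes the value at `s = 1` a dominating function as `s` decreases to `0`. -/
theorem regLog_mono {s t : ℝ} (hs : 0 < s) (hst : s ≤ t) (z : ℂ) :
    regLog Z m g s z ≤ regLog Z m g t z := by
  unfold regLog
  gcongr

theorem tendsto_regLog {z : ℂ} (hz : z ∉ Z) (hg : g z ≠ 0) {s : ℕ → ℝ}
    (hs0 : Tendsto s atTop (𝓝 0)) :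
    Tendsto (fun n => regLog Z m g (s n) z) atTop
      (𝓝 (Real.log ‖(∏ a ∈ Z, (z - a) ^ m a) * g z‖)) := by
  rw [log_norm_prod_mul hz hg]
  refine Tendsto.add_const _ (tendsto_finsetSum _ fun a ha => ?_)
  have h0 : 0 < ‖z - a‖ := norm_pos_iff.2 (sub_ne_zero.2 fun h => hz (h ▸ ha))
  refine Tendsto.const_mul _ (Tendsto.const_mul _ (Tendsto.log ?_ (by positivity)))
  simpa using (hs0.pow 2).const_add (‖z - a‖ ^ 2)

theorem integral_regLog_mul_laplacian {S K : Set ℂ} (hS : IsOpen S) (hK : IsCompact K)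
    (hKS : K ⊆ S) (hg : ∀ z ∈ S, AnalyticAt ℂ g z) (hg0 : ∀ z ∈ S, g z ≠ 0)
    {φ φ₁ φ₂ ψ₁ ψ₂ : ℂ → ℝ} (hφ : HasLineDerivTwiceOn φ φ₁ φ₂ 1 S)
    (hψ : HasLineDerivTwiceOn φ ψ₁ ψ₂ Complex.I S) (h0 : ∀ z ∉ K, φ z = 0)
    (h1 : ∀ z ∉ K, φ₁ z = 0) (h2 : ∀ z ∉ K, φ₂ z = 0) (h1' : ∀ z ∉ K, ψ₁ z = 0)
    (h2' : ∀ z ∉ K, ψ₂ z = 0) {s : ℝ} (hs : 0 < s) :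
    ∫ z, regLog Z m g s z * (φ₂ z + ψ₂ z) =
      ∑ a ∈ Z, (m a : ℝ) * ∫ z, φ z * (2 * s ^ 2 / (‖z - a‖ ^ 2 + s ^ 2) ^ 2) := by
  have key : ∀ {k : ℂ → ℝ}, ContinuousOn k S → (∀ z ∉ K, k z = 0) → Integrable k := by
    intro k hk hk0
    refine (hk.continuous_of_eq_zero_off hS hK.isClosed hKS hk0).integrable_of_hasCompactSupport ?_
    exact HasCompactSupport.intro hK hk0
  have hU : ∀ v : ℂ, HasLineDerivTwiceOn (regLog Z m g s) _ _ v S := fun v =>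
    (HasLineDerivTwiceOn.sum Z fun a _ =>
      (hasLineDerivTwiceOn_log_norm_sq_add a hs v S).const_mul (m a : ℝ)).add
      (hasLineDerivTwiceOn_log_norm hg hg0 v)
  have hc := continuousOn_regLog (Z := Z) (m := m) hg hg0 hs
  have i1 : Integrable fun z => regLog Z m g s z * φ₂ z :=
    key (hc.mul hφ.cont₂) fun z hz => by simp [h2 z hz]
  have i2 : Integrable fun z => regLog Z m g s z * ψ₂ z :=
    key (hc.mul hψ.cont₂) fun z hz => by simp [h2' z hz]
  simp_rw [mul_add]
  rw [integral_add i1 i2, integral_mul_secondDeriv (hU 1) hφ hS hK hKS h0 h1 h2,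
    integral_mul_secondDeriv (hU Complex.I) hψ hS hK hKS h0 h1' h2',
    ← integral_add]
  rotate_left
  · exact key (hφ.cont.mul (hU 1).cont₂) fun z hz => by simp [h0 z hz]
  · exact key (hφ.cont.mul (hU Complex.I).cont₂) fun z hz => by simp [h0 z hz]
  simp_rw [← integral_const_mul]
  rw [← integral_finsetSum]
  · congr 1
    ext z
    rw [← mul_add]
    simp only [one_mul, norm_one, Complex.norm_I, ← mul_assoc, Complex.I_mul_I, neg_mul,
      Complex.neg_re]
    -- The two second derivatives of `log ‖g‖` cancel, leaving only the terms of the zeros.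
    rw [add_add_add_comm, add_neg_cancel, add_zero, ← Finset.sum_add_distrib, Finset.mul_sum]
    refine Finset.sum_congr rfl fun a _ => ?_
    have hp : ‖z - a‖ ^ 2 + s ^ 2 ≠ 0 := by positivity
    -- The Laplacian of each regularised logarithm reduces to `2 s²` over the squared denominator by
    -- Pythagoras.
    have hi : inner ℝ (z - a) 1 ^ 2 + inner ℝ (z - a) Complex.I ^ 2 = ‖z - a‖ ^ 2 := by
      rw [← Complex.normSq_eq_norm_sq, Complex.normSq_apply, Complex.inner, Complex.inner]
      simp
      ring
    rw [← mul_add, ← add_div]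
    have : 1 ^ 2 * (‖z - a‖ ^ 2 + s ^ 2) - 2 * inner ℝ (z - a) 1 ^ 2 +
        (1 ^ 2 * (‖z - a‖ ^ 2 + s ^ 2) - 2 * inner ℝ (z - a) Complex.I ^ 2) = 2 * s ^ 2 := by
      linear_combination (-2) * hi
    rw [this]
    ring
  · intro a _
    refine (key (hφ.cont.mul (Continuous.continuousOn ?_)) fun z hz => by simp [h0 z hz]).const_mul _
    exact Continuous.div (by fun_prop) (by fun_prop) fun z => by positivity

end regLog

/-- The constant `K` on the ball of radius `R` repairs the sign of the Laplacian. Adding it only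
increases the right-hand side, since means of `log ‖f‖` are nonnegative; once the density is
nonnegative, `log ‖f‖` can be raised to its positive part. The argument runs for the regularised
logarithm and then lets `s → 0`. -/
theorem sum_zeros_le_integral {f : ℂ → ℂ} (hf : DifferentiableOn ℂ f (ball 0 1)) (hf0 : ‖f 0‖ = 1)
    {r : ℝ} (hr : 0 < r) (hr1 : r < 1) {φ φ₁ φ₂ ψ₁ ψ₂ : ℂ → ℝ}
    (hφ : HasLineDerivTwiceOn φ φ₁ φ₂ 1 (ball 0 1))
    (hψ : HasLineDerivTwiceOn φ ψ₁ ψ₂ Complex.I (ball 0 1))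
    (h0 : ∀ z ∉ closedBall 0 r, φ z = 0)
    (h1 : ∀ z ∉ closedBall 0 r, φ₁ z = 0) (h2 : ∀ z ∉ closedBall 0 r, φ₂ z = 0)
    (h1' : ∀ z ∉ closedBall 0 r, ψ₁ z = 0) (h2' : ∀ z ∉ closedBall 0 r, ψ₂ z = 0)
    (hφ0 : ∀ z, 0 ≤ φ z) {K R : ℝ} (hRr : R ≤ r) (hK : 0 ≤ K)
    (hW : ∀ z, 0 ≤ φ₂ z + ψ₂ z + (ball 0 R).indicator (fun _ => K) z)
    (A : Finset ℂ) (hA : ∀ a ∈ A, a ∈ closedBall 0 r ∧ f a = 0) :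
    (∫ ζ : ℂ, 2 / (1 + ‖ζ‖ ^ 2) ^ 2) * ∑ a ∈ A, analyticOrderNatAt f a * φ a ≤
      ∫ z, max (Real.log ‖f z‖) 0 * (φ₂ z + ψ₂ z + (ball 0 R).indicator (fun _ => K) z) := by
  -- A radius strictly between `r` and `1`: `f` is analytic on the larger closed disc, and the
  -- support of `φ` lies in its interior.
  set r' := (r + 1) / 2 with hr'
  have hrr : r < r' := by rw [hr']; linarith
  have hr1' : r' < 1 := by rw [hr']; linarith
  have hfa : AnalyticOnNhd ℂ f (closedBall 0 r') :=
    (hf.analyticOnNhd isOpen_ball).mono (closedBall_subset_ball hr1')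
  obtain ⟨Z, g, hZ, hg, hg0, hfg⟩ := exists_zero_factorization (hr.trans hrr) hfa
    (by rw [← norm_ne_zero_iff, hf0]; simp)
  set m := analyticOrderNatAt f with hm
  set S := ball (0 : ℂ) r' with hSdef
  have hS : IsOpen S := isOpen_ball
  have hSc : S ⊆ closedBall 0 r' := ball_subset_closedBall
  have hS1 : S ⊆ ball 0 1 := ball_subset_ball hr1'.le
  have hKS : closedBall (0 : ℂ) r ⊆ S := closedBall_subset_ball hrr
  have hBr : ball (0 : ℂ) R ⊆ closedBall 0 r := (ball_subset_ball hRr).trans ball_subset_closedBall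
  have hgS : ∀ z ∈ S, AnalyticAt ℂ g z := fun z hz => hg z (hSc hz)
  have hg0S : ∀ z ∈ S, g z ≠ 0 := fun z hz => hg0 z (hSc hz)
  have hcpt : IsCompact (closedBall (0 : ℂ) r) := isCompact_closedBall 0 r
  set W := fun z => φ₂ z + ψ₂ z with hWdef
  have hWc : ContinuousOn W S := (hφ.cont₂.add hψ.cont₂).mono hS1
  have hW0 : ∀ z ∉ closedBall (0 : ℂ) r, W z = 0 := fun z hz => by simp [hWdef, h2 z hz, h2' z hz]
  have key : ∀ {k : ℂ → ℝ}, ContinuousOn k S → (∀ z ∉ closedBall (0 : ℂ) r, k z = 0) →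
      Integrable k := by
    intro k hk hk0
    refine (hk.continuous_of_eq_zero_off hS hcpt.isClosed hKS hk0).integrable_of_hasCompactSupport ?_
    exact HasCompactSupport.intro hcpt hk0
  set ι := (ball (0 : ℂ) R).indicator (fun _ => K) with hι
  have hint : ∀ {k : ℂ → ℝ}, ContinuousOn k S → Integrable (fun z => k z * (W z + ι z)) := by
    intro k hk
    have i1 : Integrable fun z => k z * W z := key (hk.mul hWc) fun z hz => by simp [hW0 z hz]
    have i2 : Integrable fun z => k z * ι z := by
      have : (fun z => k z * ι z) = (ball (0 : ℂ) R).indicator fun z => k z * K := by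
        ext z
        by_cases hz : z ∈ ball (0 : ℂ) R <;> simp [hι, hz]
      rw [this, integrable_indicator_iff measurableSet_ball]
      exact ((hk.mono hKS).mul continuousOn_const |>.integrableOn_compact hcpt).mono_set hBr
    refine (i1.add i2).congr (Eventually.of_forall fun z => ?_)
    simp only [Pi.add_apply, mul_add]
  set s : ℕ → ℝ := fun n => 1 / ((n : ℝ) + 1) with hs
  have hspos : ∀ n, 0 < s n := fun n => by simp only [hs]; positivity
  have hs1 : ∀ n, s n ≤ 1 := fun n => by
    simp only [hs]
    rw [div_le_one (by positivity)]
    linarith [(Nat.cast_nonneg n : (0 : ℝ) ≤ n)]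
  have hs0 : Tendsto s atTop (𝓝 0) := tendsto_one_div_add_atTop_nhds_zero_nat
  have hUc : ∀ n, ContinuousOn (regLog Z m g (s n)) S := fun n =>
    continuousOn_regLog hgS hg0S (hspos n)
  have hmean : ∀ n, 0 ≤ ∫ z in ball 0 R, regLog Z m g (s n) z := by
    intro n
    refine setIntegral_ball_nonneg ((hUc n).mono ((closedBall_subset_closedBall hRr).trans hKS)) ?_
    have hfin : ((Z : Set ℂ).image norm).Finite := Z.finite_toSet.image _
    -- The finitely many radii of circles meeting `Z` form a null set. On the other circles
    -- `log_norm_le_regLog` applies; at a zero it could fail, as `Real.log 0 = 0`.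
    filter_upwards [compl_mem_ae_iff.2 (hfin.measure_zero volume)] with ρ hρ hρ'
    have hρZ : ∀ z ∈ sphere (0 : ℂ) |ρ|, z ∉ Z := fun z hz hzZ => hρ ⟨z, hzZ, by
      rw [mem_sphere_zero_iff_norm.1 hz, abs_of_pos hρ'.1]⟩
    have hρr' : ρ < r' := hρ'.2.trans_le (hRr.trans hrr.le)
    have hsub : sphere (0 : ℂ) |ρ| ⊆ S := by
      rw [abs_of_pos hρ'.1]
      exact sphere_subset_closedBall.trans (closedBall_subset_ball hρr')
    refine (circleAverage_log_norm_nonneg hρ'.1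
      (hfa.mono (closedBall_subset_closedBall hρr'.le)) hf0).trans ?_
    refine Real.circleAverage_mono ?_ ?_ fun z hz => ?_
    · exact MeromorphicOn.circleIntegrable_log_norm
        ((hfa.mono (hsub.trans hSc)).meromorphicOn)
    · exact ContinuousOn.circleIntegrable' ((hUc n).mono hsub)
    · rw [hfg z (hsub hz)]
      exact log_norm_le_regLog (hρZ z hz) (hg0S z (hsub hz)) _
  have hineq : ∀ n, ∑ a ∈ Z, (m a : ℝ) * ∫ z, φ z * (2 * s n ^ 2 / (‖z - a‖ ^ 2 + s n ^ 2) ^ 2) ≤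
      ∫ z, max (regLog Z m g (s n) z) 0 * (W z + ι z) := by
    intro n
    rw [← integral_regLog_mul_laplacian hS hcpt hKS hgS hg0S (hφ.mono hS1) (hψ.mono hS1) h0 h1 h2
      h1' h2' (hspos n)]
    have e1 : ∫ z, regLog Z m g (s n) z * (W z + ι z) =
        (∫ z, regLog Z m g (s n) z * W z) + K * ∫ z in ball 0 R, regLog Z m g (s n) z := by
      have i1 : Integrable fun z => regLog Z m g (s n) z * W z :=
        key ((hUc n).mul hWc) fun z hz => by simp [hW0 z hz]
      have i2 : Integrable fun z => regLog Z m g (s n) z * ι z := by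
        refine ((hint (hUc n)).sub i1).congr (Eventually.of_forall fun z => ?_)
        simp only [Pi.sub_apply]
        ring
      simp_rw [mul_add]
      rw [integral_add i1 i2, ← integral_const_mul, ← integral_indicator measurableSet_ball]
      congr 2
      ext z
      by_cases hz : z ∈ ball (0 : ℂ) R
      · simp only [hι, indicator_of_mem hz]; ring
      · simp only [hι, indicator_of_notMem hz]; ring
    have e2 : ∫ z, regLog Z m g (s n) z * (W z + ι z) ≤
        ∫ z, max (regLog Z m g (s n) z) 0 * (W z + ι z) :=
      integral_mono (hint (hUc n)) (hint ((hUc n).sup continuousOn_const)) fun z =>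
        mul_le_mul_of_nonneg_right (le_max_left _ _) (hW z)
    have := mul_nonneg hK (hmean n)
    simp only [hWdef] at *
    linarith
  have hφc : Continuous φ := (hφ.cont.mono hS1).continuous_of_eq_zero_off hS hcpt.isClosed hKS h0
  obtain ⟨C, hC⟩ : ∃ C, ∀ z, |φ z| ≤ C := by
    obtain ⟨C, hC⟩ := hφc.bounded_above_of_compact_support (HasCompactSupport.intro hcpt h0)
    exact ⟨C, hC⟩
  have hlim1 := tendsto_finsetSum Z fun a _ =>
    (tendsto_integral_mul_kernel hφc hC a hspos hs0).const_mul (m a : ℝ)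
  have hlim2 : Tendsto (fun n => ∫ z, max (regLog Z m g (s n) z) 0 * (W z + ι z)) atTop
      (𝓝 (∫ z, max (Real.log ‖f z‖) 0 * (W z + ι z))) := by
    refine tendsto_integral_of_dominated_convergence
      (fun z => max (regLog Z m g 1 z) 0 * (W z + ι z))
      (fun n => (hint ((hUc n).sup continuousOn_const)).aestronglyMeasurable)
      (hint ((continuousOn_regLog hgS hg0S one_pos).sup continuousOn_const))
      (fun n => Eventually.of_forall fun z => ?_) ?_
    · rw [Real.norm_eq_abs, abs_of_nonneg (mul_nonneg (le_max_right _ _) (hW z))]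
      exact mul_le_mul_of_nonneg_right (max_le_max (regLog_mono (hspos n) (hs1 n) z) le_rfl) (hW z)
    · filter_upwards [compl_mem_ae_iff.2 (Z.finite_toSet.measure_zero volume)] with z hz
      by_cases hzr : z ∈ closedBall (0 : ℂ) r
      · refine Tendsto.mul_const _ (Tendsto.max ?_ tendsto_const_nhds)
        rw [hfg z (hKS hzr)]
        exact tendsto_regLog hz (hg0S z (hKS hzr)) hs0
      · have : W z + ι z = 0 := by
          rw [hW0 z hzr, hι, indicator_of_notMem fun h => hzr (hBr h), add_zero]
        simp [this]
  have hmain := le_of_tendsto_of_tendsto' hlim1 hlim2 hineq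
  refine le_trans ?_ hmain
  rw [Finset.mul_sum]
  -- Points of `Z` outside `A` contribute nonnegative terms and may be dropped.
  have hAZ : A ⊆ Z := fun a ha => hZ a (hSc (hKS (hA a ha).1)) (hA a ha).2
  refine le_trans (Finset.sum_le_sum_of_subset_of_nonneg hAZ fun a _ _ => ?_)
    (Finset.sum_le_sum fun a _ => le_of_eq ?_)
  · exact mul_nonneg integral_fubiniStudy_pos.le (mul_nonneg (Nat.cast_nonneg _) (hφ0 a))
  · ring

/-! ### The radial profile with cutoff at `δ`. -/

/-- The derivative of `radialProfile`: a cutoff at `δ` of `x ^ θ * exp (κ x)`. -/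
noncomputable def profileDeriv (θ κ δ x : ℝ) : ℝ :=
  max (x - δ) 0 ^ 2 * x ^ (θ - 2) * Real.exp (κ * x)

/-- The second derivative of `radialProfile`. -/
noncomputable def profileDeriv₂ (θ κ δ x : ℝ) : ℝ :=
  (2 * max (x - δ) 0 * x ^ (θ - 2) +
    max (x - δ) 0 ^ 2 * ((θ - 2) * x ^ (θ - 2 - 1) + κ * x ^ (θ - 2))) * Real.exp (κ * x)

/-- A convex function vanishing for `x ≤ δ` and comparable to `x ^ (θ + 1)` for larger `x`. -/
noncomputable def radialProfile (θ κ δ x : ℝ) : ℝ := ∫ t in (0 : ℝ)..x, profileDeriv θ κ δ t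

/-- The derivative of the cutoff factor `(1 - δ / x)₊²`. -/
noncomputable def cutoffDeriv (δ x : ℝ) : ℝ := 2 * δ * max (x - δ) 0 / x ^ 3

/-- The square makes the cutoff continuously differentiable at `δ`, so that the profile, one
integration higher, is twice continuously differentiable. -/
theorem hasDerivAt_max_sq (δ x : ℝ) :
    HasDerivAt (fun x => max (x - δ) 0 ^ 2) (2 * max (x - δ) 0) x := by
  rcases lt_trichotomy x δ with h | rfl | h
  · refine ((hasDerivAt_const x (0 : ℝ)).congr_of_eventuallyEq ?_).congr_deriv ?_
    · filter_upwards [Iio_mem_nhds h] with y hy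
      rw [max_eq_right (by linarith [mem_Iio.1 hy])]
      simp
    · rw [max_eq_right (by linarith)]
      simp
  · rw [hasDerivAt_iff_isLittleO]
    simp only [sub_self, max_self, mul_zero, smul_zero, sub_zero, ne_eq, OfNat.ofNat_ne_zero,
      not_false_eq_true, zero_pow]
    have h1 : (fun y => max (y - x) 0 ^ 2) =O[𝓝 x] fun y => (y - x) ^ 2 := by
      refine Asymptotics.IsBigO.of_bound 1 (Eventually.of_forall fun y => ?_)
      rw [norm_pow, norm_pow, one_mul]
      gcongr
      rw [Real.norm_eq_abs, Real.norm_eq_abs, abs_of_nonneg (le_max_right _ _)]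
      exact max_le (le_abs_self _) (abs_nonneg _)
    refine h1.trans_isLittleO ?_
    have h2 := Asymptotics.isLittleO_pow_id (𝕜 := ℝ) (one_lt_two)
    have h3 : Tendsto (fun y => y - x) (𝓝 x) (𝓝 0) := by
      have : Continuous fun y => y - x := by fun_prop
      simpa using this.tendsto x
    exact h2.comp_tendsto h3
  · refine ((((hasDerivAt_id x).sub_const δ).pow 2).congr_of_eventuallyEq ?_).congr_deriv ?_
    · filter_upwards [Ioi_mem_nhds h] with y hy
      rw [max_eq_left (by linarith [mem_Ioi.1 hy])]
      simp
    · rw [max_eq_left (by linarith)]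
      simp

section profile

variable {θ κ δ : ℝ}

theorem profileDeriv_of_le {x : ℝ} (hx : x ≤ δ) : profileDeriv θ κ δ x = 0 := by
  rw [profileDeriv, max_eq_right (by linarith)]
  simp

theorem profileDeriv₂_of_le {x : ℝ} (hx : x ≤ δ) : profileDeriv₂ θ κ δ x = 0 := by
  rw [profileDeriv₂, max_eq_right (by linarith)]
  simp

theorem hasDerivAt_profileDeriv (hδ : 0 < δ) (x : ℝ) :
    HasDerivAt (profileDeriv θ κ δ) (profileDeriv₂ θ κ δ x) x := by
  rcases lt_or_ge x δ with h | h
  · rw [profileDeriv₂_of_le h.le]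
    refine (hasDerivAt_const x (0 : ℝ)).congr_of_eventuallyEq ?_
    filter_upwards [Iio_mem_nhds h] with y hy
    exact profileDeriv_of_le (le_of_lt hy)
  · have hx : 0 < x := hδ.trans_le h
    refine (((hasDerivAt_max_sq δ x).fun_mul (Real.hasDerivAt_rpow_const
      (p := θ - 2) (Or.inl hx.ne'))).fun_mul ((hasDerivAt_id x).const_mul κ).exp).congr_deriv ?_
    rw [profileDeriv₂]
    simp only [id, mul_one]
    ring

theorem continuous_profileDeriv (hδ : 0 < δ) : Continuous (profileDeriv θ κ δ) :=
  continuous_iff_continuousAt.2 fun x => (hasDerivAt_profileDeriv hδ x).continuousAt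

theorem continuous_profileDeriv₂ (hδ : 0 < δ) : Continuous (profileDeriv₂ θ κ δ) := by
  refine continuous_iff_continuousAt.2 fun x => ?_
  rcases lt_or_ge x δ with h | h
  · refine (continuousAt_const (y := (0 : ℝ))).congr ?_
    filter_upwards [Iio_mem_nhds h] with y hy
    exact (profileDeriv₂_of_le (le_of_lt hy)).symm
  · have hx : x ≠ 0 := (hδ.trans_le h).ne'
    have h1 := Real.continuousAt_rpow_const x (θ - 2) (Or.inl hx)
    have h2 := Real.continuousAt_rpow_const x (θ - 2 - 1) (Or.inl hx)
    unfold profileDeriv₂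
    fun_prop

theorem hasDerivAt_radialProfile (hδ : 0 < δ) (x : ℝ) :
    HasDerivAt (radialProfile θ κ δ) (profileDeriv θ κ δ x) x :=
  ((continuous_profileDeriv hδ).integral_hasStrictDerivAt 0 x).hasDerivAt

theorem profileDeriv_nonneg (hδ : 0 < δ) (x : ℝ) : 0 ≤ profileDeriv θ κ δ x := by
  rcases le_or_gt x δ with h | h
  · exact (profileDeriv_of_le h).ge
  · have hx : 0 < x := hδ.trans h
    unfold profileDeriv
    positivity

theorem radialProfile_of_le {x : ℝ} (hδ : 0 < δ) (hx : x ≤ δ) : radialProfile θ κ δ x = 0 := by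
  refine intervalIntegral.integral_zero_ae (Eventually.of_forall fun t ht => profileDeriv_of_le ?_)
  exact ht.2.trans (max_le hδ.le hx)

theorem profileDeriv_eq {x : ℝ} (hx : 0 < x) :
    profileDeriv θ κ δ x = x ^ θ * (max (x - δ) 0 / x) ^ 2 * Real.exp (κ * x) := by
  rw [profileDeriv, Real.rpow_sub hx]
  norm_num
  field_simp

/-- Product rule for `x ^ θ`, the cutoff factor `(1 - δ / x)₊²` and `exp (κ x)`. The term with
`cutoffDeriv` is nonnegative, hence harmless for subharmonicity, and is kept separate because it is
controlled only after integration. -/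
theorem profileDeriv₂_eq {x : ℝ} (hx : 0 < x) :
    profileDeriv₂ θ κ δ x = (κ + θ / x) * profileDeriv θ κ δ x +
      x ^ θ * cutoffDeriv δ x * Real.exp (κ * x) := by
  have h2 : x ^ (θ - 2) = x ^ θ / x ^ 2 := by
    rw [Real.rpow_sub hx]
    norm_num
  have h3 : x ^ (θ - 2 - 1) = x ^ θ / x ^ 3 := by
    rw [Real.rpow_sub hx, h2, Real.rpow_one, div_div]
    ring
  rw [profileDeriv₂, profileDeriv_eq hx, cutoffDeriv, h3, h2]
  rcases le_total x δ with h | h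
  · rw [max_eq_right (by linarith)]
    simp
  · rw [max_eq_left (by linarith)]
    field_simp
    ring

theorem max_div_le_one {x : ℝ} (hδ : 0 < δ) (hx : 0 < x) : max (x - δ) 0 / x ≤ 1 := by
  rw [div_le_one hx]
  exact max_le (by linarith) hx.le

theorem cutoffDeriv_nonneg {x : ℝ} (hδ : 0 < δ) (hx : 0 < x) : 0 ≤ cutoffDeriv δ x := by
  unfold cutoffDeriv
  positivity

theorem profileDeriv_le {x : ℝ} (hδ : 0 < δ) (hκ : 0 ≤ κ) (hx : 0 < x) (hx1 : x ≤ 1) :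
    profileDeriv θ κ δ x ≤ Real.exp κ * x ^ θ := by
  rw [profileDeriv_eq hx, mul_comm (Real.exp κ)]
  have h1 : (max (x - δ) 0 / x) ^ 2 ≤ 1 :=
    pow_le_one₀ (by positivity) (max_div_le_one hδ hx)
  have h2 : Real.exp (κ * x) ≤ Real.exp κ := Real.exp_le_exp.2 (by nlinarith)
  have h3 : x ^ θ * (max (x - δ) 0 / x) ^ 2 ≤ x ^ θ := mul_le_of_le_one_right (by positivity) h1
  exact mul_le_mul h3 h2 (by positivity) (by positivity)

theorem profileDeriv₂_le {x : ℝ} (hδ : 0 < δ) (hκ : 0 ≤ κ) (hθ : 0 ≤ θ) (hx : 0 < x)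
    (hx1 : x ≤ 1) :
    profileDeriv₂ θ κ δ x ≤ Real.exp κ * x ^ θ * (κ + θ / x + cutoffDeriv δ x) := by
  have h1 := profileDeriv_le (θ := θ) hδ hκ hx hx1
  have h2 : Real.exp (κ * x) ≤ Real.exp κ := Real.exp_le_exp.2 (by nlinarith)
  have h3 := cutoffDeriv_nonneg hδ hx
  rw [profileDeriv₂_eq hx]
  have h4 : (κ + θ / x) * profileDeriv θ κ δ x ≤ (κ + θ / x) * (Real.exp κ * x ^ θ) :=
    mul_le_mul_of_nonneg_left h1 (by positivity)
  have h5 : x ^ θ * cutoffDeriv δ x * Real.exp (κ * x) ≤ x ^ θ * cutoffDeriv δ x * Real.exp κ :=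
    mul_le_mul_of_nonneg_left h2 (by positivity)
  linarith

theorem le_profileDeriv₂ {x : ℝ} (hδ : 0 < δ) (hx : 0 < x) :
    (κ + θ / x) * profileDeriv θ κ δ x ≤ profileDeriv₂ θ κ δ x := by
  rw [profileDeriv₂_eq hx]
  have := cutoffDeriv_nonneg hδ hx
  have : 0 ≤ x ^ θ * cutoffDeriv δ x * Real.exp (κ * x) := by positivity
  linarith

theorem radialProfile_nonneg {x : ℝ} (hδ : 0 < δ) : 0 ≤ radialProfile θ κ δ x := by
  rcases le_total x 0 with h | h
  · exact (radialProfile_of_le hδ (h.trans hδ.le)).ge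
  · exact intervalIntegral.integral_nonneg h fun t _ => profileDeriv_nonneg hδ t

theorem radialProfile_le {x : ℝ} (hδ : 0 < δ) (hκ : 0 ≤ κ) (hθ : 0 ≤ θ) (hx : 0 < x)
    (hx1 : x ≤ 1) : radialProfile θ κ δ x ≤ Real.exp κ * x ^ θ * x := by
  have hc := continuous_profileDeriv (θ := θ) (κ := κ) hδ
  have := intervalIntegral.integral_mono_on (μ := volume) hx.le (hc.intervalIntegrable 0 x)
    (intervalIntegrable_const (c := Real.exp κ * x ^ θ)) (fun t ht => by
      rcases le_or_gt t 0 with h | h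
      · rw [profileDeriv_of_le (h.trans hδ.le)]
        positivity
      · refine (profileDeriv_le hδ hκ h (ht.2.trans hx1)).trans ?_
        gcongr
        exact ht.2)
  rw [intervalIntegral.integral_const, smul_eq_mul] at this
  rw [radialProfile]
  linarith

theorem le_radialProfile {x : ℝ} (hδ : 0 < δ) (hκ : 0 ≤ κ) (hθ : 0 ≤ θ) (hx : 4 * δ ≤ x) :
    (x / 2) ^ θ / 4 * (x / 2) ≤ radialProfile θ κ δ x := by
  have hx0 : 0 < x := by linarith
  have hc := continuous_profileDeriv (θ := θ) (κ := κ) hδ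
  have h1 := intervalIntegral.integral_mono_on (μ := volume) (show x / 2 ≤ x by linarith)
    (intervalIntegrable_const (c := (x / 2) ^ θ / 4)) (hc.intervalIntegrable (x / 2) x)
    (fun t ht => by
      have ht0 : 0 < t := by linarith [ht.1]
      rw [profileDeriv_eq ht0]
      -- On `[x / 2, x]` one has `t ≥ 2 δ`, so the cutoff factor is at least `1 / 4`.
      have h2 : (1 / 2 : ℝ) ≤ max (t - δ) 0 / t := by
        rw [le_div_iff₀ ht0]
        exact le_trans (by linarith [ht.1]) (le_max_left _ _)
      have h3 : (1 / 4 : ℝ) ≤ (max (t - δ) 0 / t) ^ 2 := by nlinarith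
      have h4 : (1 : ℝ) ≤ Real.exp (κ * t) := Real.one_le_exp (by positivity)
      have h5 : (x / 2) ^ θ ≤ t ^ θ := Real.rpow_le_rpow (by positivity) ht.1 hθ
      have h6 : (x / 2) ^ θ * (1 / 4) ≤ t ^ θ * (max (t - δ) 0 / t) ^ 2 :=
        mul_le_mul h5 h3 (by norm_num) (by positivity)
      have h7 : 0 ≤ t ^ θ * (max (t - δ) 0 / t) ^ 2 := by positivity
      nlinarith)
  have h2 : radialProfile θ κ δ x = (∫ t in (0 : ℝ)..(x / 2), profileDeriv θ κ δ t) +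
      ∫ t in (x / 2)..x, profileDeriv θ κ δ t :=
    (intervalIntegral.integral_add_adjacent_intervals (hc.intervalIntegrable _ _)
      (hc.intervalIntegrable _ _)).symm
  have h3 : 0 ≤ ∫ t in (0 : ℝ)..(x / 2), profileDeriv θ κ δ t :=
    intervalIntegral.integral_nonneg (by positivity) fun t _ => profileDeriv_nonneg hδ t
  rw [intervalIntegral.integral_const, smul_eq_mul] at h1
  linarith

end profile

/-! ### The Laplacian of the test function: formula and bounds. -/

/-- The logarithm of `∏ⱼ |z - ηⱼ| ^ αⱼ`. -/
noncomputable def logWeight {n : ℕ} (η : Fin n → ℂ) (α : Fin n → ℝ) (z : ℂ) : ℝ :=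
  ∑ j, α j * Real.log ‖z - η j‖

/-- The logarithmic derivative `∑ⱼ αⱼ / (z - ηⱼ)` of `∏ⱼ (z - ηⱼ) ^ αⱼ`. -/
noncomputable def weightLogDeriv {n : ℕ} (η : Fin n → ℂ) (α : Fin n → ℝ) (z : ℂ) : ℂ :=
  ∑ j, α j / (z - η j)

/-- `∑ⱼ |αⱼ| (1 - |z|²) / |z - ηⱼ|²`. -/
noncomputable def poissonSum {n : ℕ} (η : Fin n → ℂ) (α : Fin n → ℝ) (z : ℂ) : ℝ :=
  ∑ j, |α j| * ((1 - ‖z‖ ^ 2) / ‖z - η j‖ ^ 2)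

/-- The Laplacian of `radialProfile (1 - |z|²) * ∏ⱼ |z - ηⱼ| ^ αⱼ` in the disc. -/
noncomputable def testLaplacian {n : ℕ} (η : Fin n → ℂ) (α : Fin n → ℝ) (θ κ δ : ℝ) (z : ℂ) : ℝ :=
  (4 * profileDeriv₂ θ κ δ (1 - ‖z‖ ^ 2) * ‖z‖ ^ 2 - 4 * profileDeriv θ κ δ (1 - ‖z‖ ^ 2)
    - 4 * profileDeriv θ κ δ (1 - ‖z‖ ^ 2) * (z * weightLogDeriv η α z).re
    + radialProfile θ κ δ (1 - ‖z‖ ^ 2) * ‖weightLogDeriv η α z‖ ^ 2) *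
    Real.exp (logWeight η α z)

section

variable {n : ℕ} {η : Fin n → ℂ} {α : Fin n → ℝ} {θ κ δ : ℝ}

theorem sub_ne_zero_of_mem_ball {z a : ℂ} (hz : z ∈ ball (0 : ℂ) 1) (ha : ‖a‖ = 1) : z - a ≠ 0 := by
  rw [sub_ne_zero]
  rintro rfl
  rw [mem_ball_zero_iff, ha] at hz
  exact lt_irrefl _ hz

theorem one_sub_sq_pos {z : ℂ} (hz : z ∈ ball (0 : ℂ) 1) : 0 < 1 - ‖z‖ ^ 2 := by
  rw [mem_ball_zero_iff] at hz
  nlinarith [norm_nonneg z]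

theorem logDeriv_sub_const (a z : ℂ) : logDeriv (fun z : ℂ => z - a) z = 1 / (z - a) := by
  rw [logDeriv_apply, deriv_sub_const, deriv_id'']

/-- `logWeight` is harmonic in the disc, so its second derivatives drop out and only its squared
gradient `‖weightLogDeriv‖²` remains. -/
theorem exists_testFn_derivs (hη : ∀ j, ‖η j‖ = 1) (hδ : 0 < δ) : ∃ φ₁ φ₂ ψ₁ ψ₂ : ℂ → ℝ,
    HasLineDerivTwiceOn
      (fun z => radialProfile θ κ δ (1 - ‖z‖ ^ 2) * Real.exp (logWeight η α z))
      φ₁ φ₂ 1 (ball 0 1) ∧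
    HasLineDerivTwiceOn
      (fun z => radialProfile θ κ δ (1 - ‖z‖ ^ 2) * Real.exp (logWeight η α z))
      ψ₁ ψ₂ Complex.I (ball 0 1) ∧
    (∀ z : ℂ, 1 - ‖z‖ ^ 2 ≤ δ → φ₁ z = 0 ∧ φ₂ z = 0 ∧ ψ₁ z = 0 ∧ ψ₂ z = 0) ∧
    ∀ z ∈ ball (0 : ℂ) 1, φ₂ z + ψ₂ z = testLaplacian η α θ κ δ z := by
  have hL : ∀ v : ℂ, HasLineDerivTwiceOn (logWeight η α) _ _ v (ball 0 1) := fun v =>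
    HasLineDerivTwiceOn.sum Finset.univ fun j _ =>
      (hasLineDerivTwiceOn_log_norm (k := fun z => z - η j) (S := ball 0 1)
        (fun z _ => by fun_prop) (fun z hz => sub_ne_zero_of_mem_ball hz (hη j)) v).const_mul (α j)
  have h := fun v => (hL v).comp_mul_exp (hasDerivAt_radialProfile (θ := θ) (κ := κ) hδ)
    (hasDerivAt_profileDeriv hδ) (continuous_profileDeriv₂ hδ)
  refine ⟨_, _, _, _, h 1, h Complex.I, fun z hz => ?_, fun z hz => ?_⟩
  · simp [radialProfile_of_le hδ hz, profileDeriv_of_le hz, profileDeriv₂_of_le hz]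
  · have hG : ∀ v : ℂ, ∑ j, α j * (v * logDeriv (fun z => z - η j) z).re =
        (v * weightLogDeriv η α z).re := fun v => by
      rw [weightLogDeriv, Finset.mul_sum, Complex.re_sum]
      refine Finset.sum_congr rfl fun j _ => ?_
      rw [logDeriv_sub_const, ← Complex.re_ofReal_mul]
      congr 1
      ring
    have h2 : ∑ j, α j * (Complex.I * (Complex.I * deriv (logDeriv fun z => z - η j) z)).re =
        -∑ j, α j * (1 * (1 * deriv (logDeriv fun z => z - η j) z)).re := by
      rw [← Finset.sum_neg_distrib]
      refine Finset.sum_congr rfl fun j _ => ?_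
      rw [← mul_assoc, Complex.I_mul_I]
      simp
    simp only [h2]
    rw [← add_mul, testLaplacian, hG, hG]
    congr 1
    rw [← Complex.normSq_eq_norm_sq z, ← Complex.normSq_eq_norm_sq (weightLogDeriv η α z),
      Complex.normSq_apply, Complex.normSq_apply, Complex.inner, Complex.inner]
    simp
    ring

/-- For `|η| = 1` the real part of `2 z / (z - η)` is `1` minus the Poisson kernel. -/
theorem re_mul_weightLogDeriv (hη : ∀ j, ‖η j‖ = 1) {z : ℂ} (hz : z ∈ ball (0 : ℂ) 1) :
    (z * weightLogDeriv η α z).re =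
      ∑ j, α j / 2 * (1 - (1 - ‖z‖ ^ 2) / ‖z - η j‖ ^ 2) := by
  rw [weightLogDeriv, Finset.mul_sum, Complex.re_sum]
  refine Finset.sum_congr rfl fun j _ => ?_
  have h0 := sub_ne_zero_of_mem_ball hz (hη j)
  have h1 : Complex.normSq (z - η j) ≠ 0 := by simpa using h0
  have h2 : (η j).re * (η j).re + (η j).im * (η j).im = 1 := by
    rw [← Complex.normSq_apply, Complex.normSq_eq_norm_sq, hη j, one_pow]
  rw [show z * (α j / (z - η j)) = (α j : ℂ) * (z / (z - η j)) by ring, Complex.re_ofReal_mul,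
    Complex.div_re, ← Complex.normSq_eq_norm_sq, ← Complex.normSq_eq_norm_sq]
  rw [Complex.normSq_apply z]
  field_simp
  rw [Complex.normSq_apply]
  simp only [Complex.sub_re, Complex.sub_im]
  linear_combination (-α j) * h2

theorem norm_weightLogDeriv_sq_le {z : ℂ} :
    ‖weightLogDeriv η α z‖ ^ 2 ≤ (∑ j, |α j|) * ∑ j, |α j| * (1 / ‖z - η j‖ ^ 2) := by
  have h1 : ‖weightLogDeriv η α z‖ ≤ ∑ j, |α j| / ‖z - η j‖ := by
    refine (norm_sum_le _ _).trans (le_of_eq (Finset.sum_congr rfl fun j _ => ?_))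
    rw [norm_div, Complex.norm_real, Real.norm_eq_abs]
  refine (pow_le_pow_left₀ (norm_nonneg _) h1 2).trans ?_
  -- Cauchy–Schwarz with weights `|αⱼ|`.
  refine Finset.sum_sq_le_sum_mul_sum_of_sq_le_mul _ (fun j _ => abs_nonneg _)
    (fun j _ => by positivity) fun j _ => le_of_eq ?_
  ring

theorem poissonSum_nonneg {z : ℂ} (hz : z ∈ ball (0 : ℂ) 1) : 0 ≤ poissonSum η α z := by
  have := one_sub_sq_pos hz
  exact Finset.sum_nonneg fun j _ => by positivity

theorem abs_re_mul_weightLogDeriv_le (hη : ∀ j, ‖η j‖ = 1) {z : ℂ} (hz : z ∈ ball (0 : ℂ) 1) :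
    |(z * weightLogDeriv η α z).re| ≤ (∑ j, |α j|) / 2 + poissonSum η α z / 2 := by
  have := one_sub_sq_pos hz
  rw [re_mul_weightLogDeriv hη hz, poissonSum, ← add_div, ← Finset.sum_add_distrib,
    Finset.sum_div]
  refine (Finset.abs_sum_le_sum_abs _ _).trans (Finset.sum_le_sum fun j _ => ?_)
  rw [abs_mul, abs_div, abs_two]
  have h1 : |1 - (1 - ‖z‖ ^ 2) / ‖z - η j‖ ^ 2| ≤ 1 + (1 - ‖z‖ ^ 2) / ‖z - η j‖ ^ 2 := by
    have : 0 ≤ (1 - ‖z‖ ^ 2) / ‖z - η j‖ ^ 2 := by positivity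
    rw [abs_le]
    constructor <;> linarith
  have := mul_le_mul_of_nonneg_left h1 (show 0 ≤ |α j| / 2 by positivity)
  linarith

theorem testLaplacian_le (hη : ∀ j, ‖η j‖ = 1) (hδ : 0 < δ) (hκ : 0 ≤ κ) (hθ : 0 ≤ θ) {z : ℂ}
    (hz : z ∈ ball (0 : ℂ) 1) :
    testLaplacian η α θ κ δ z ≤ Real.exp κ * (4 * κ + 6 + 3 * ∑ j, |α j|) *
      ((1 - ‖z‖ ^ 2) ^ θ * Real.exp (logWeight η α z) *
        ((1 + θ / (1 - ‖z‖ ^ 2) + poissonSum η α z) + cutoffDeriv δ (1 - ‖z‖ ^ 2))) := by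
  set w := 1 - ‖z‖ ^ 2 with hw
  set A := ∑ j, |α j| with hA
  set S := poissonSum η α z with hS
  have hw0 : 0 < w := one_sub_sq_pos hz
  have hw1 : w ≤ 1 := by rw [hw]; nlinarith [norm_nonneg z]
  have hA0 : 0 ≤ A := Finset.sum_nonneg fun j _ => abs_nonneg _
  have hS0 : 0 ≤ S := poissonSum_nonneg hz
  have hX := (abs_le.1 (abs_re_mul_weightLogDeriv_le (α := α) hη hz)).1
  have hY : w * ‖weightLogDeriv η α z‖ ^ 2 ≤ A * S := by
    refine (mul_le_mul_of_nonneg_left norm_weightLogDeriv_sq_le hw0.le).trans (le_of_eq ?_)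
    rw [hS, poissonSum, mul_left_comm, Finset.mul_sum (a := w)]
    congr 1
    refine Finset.sum_congr rfl fun j _ => ?_
    ring
  have k0 := profileDeriv_nonneg (θ := θ) (κ := κ) hδ w
  have k1 := profileDeriv_le (θ := θ) hδ hκ hw0 hw1
  have k2 := profileDeriv₂_le hδ hκ hθ hw0 hw1
  have k3 := le_profileDeriv₂ (θ := θ) (κ := κ) hδ hw0
  have k4 := radialProfile_le (θ := θ) hδ hκ hθ hw0 hw1
  have hρ := cutoffDeriv_nonneg hδ hw0
  have hq : 0 ≤ θ / w := by positivity
  have k5 : 0 ≤ profileDeriv₂ θ κ δ w := le_trans (by positivity) k3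
  have hz2 : ‖z‖ ^ 2 ≤ 1 := by linarith
  set P := Real.exp κ * w ^ θ with hP
  have hP0 : 0 ≤ P := by positivity
  have t1 : profileDeriv₂ θ κ δ w * ‖z‖ ^ 2 ≤ P * (κ + θ / w + cutoffDeriv δ w) :=
    (mul_le_of_le_one_right k5 hz2).trans k2
  have t2 : -(profileDeriv θ κ δ w * (z * weightLogDeriv η α z).re) ≤ P * (A / 2 + S / 2) := by
    have h1 : profileDeriv θ κ δ w * -(z * weightLogDeriv η α z).re ≤
        profileDeriv θ κ δ w * (A / 2 + S / 2) := mul_le_mul_of_nonneg_left (by linarith) k0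
    have h2 : profileDeriv θ κ δ w * (A / 2 + S / 2) ≤ P * (A / 2 + S / 2) :=
      mul_le_mul_of_nonneg_right k1 (by positivity)
    linarith
  have t3 : radialProfile θ κ δ w * ‖weightLogDeriv η α z‖ ^ 2 ≤ P * (A * S) := by
    refine (mul_le_mul_of_nonneg_right k4 (by positivity)).trans ?_
    rw [mul_assoc P]
    exact mul_le_mul_of_nonneg_left hY hP0
  -- The constant `4 κ + 6 + 3 A` is chosen to absorb all coefficients at once.
  have t4 : P * (4 * (κ + θ / w + cutoffDeriv δ w) + 2 * A + 2 * S + A * S) ≤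
      P * ((4 * κ + 6 + 3 * A) * ((1 + θ / w + S) + cutoffDeriv δ w)) := by
    refine mul_le_mul_of_nonneg_left ?_ hP0
    have : 0 ≤ κ * (θ / w) := by positivity
    have : 0 ≤ κ * S := by positivity
    have : 0 ≤ κ * cutoffDeriv δ w := by positivity
    have : 0 ≤ A * (θ / w) := by positivity
    have : 0 ≤ A * S := by positivity
    have : 0 ≤ A * cutoffDeriv δ w := by positivity
    linarith
  rw [testLaplacian]
  have : 4 * profileDeriv₂ θ κ δ w * ‖z‖ ^ 2 - 4 * profileDeriv θ κ δ w
    - 4 * profileDeriv θ κ δ w * (z * weightLogDeriv η α z).re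
    + radialProfile θ κ δ w * ‖weightLogDeriv η α z‖ ^ 2 ≤
      P * ((4 * κ + 6 + 3 * A) * ((1 + θ / w + S) + cutoffDeriv δ w)) := by linarith
  refine (mul_le_mul_of_nonneg_right this (Real.exp_pos _).le).trans (le_of_eq ?_)
  rw [hP]
  ring

/-- A crude bound, needed only in the central disc: the nonnegative terms are discarded. -/
theorem neg_le_testLaplacian (hη : ∀ j, ‖η j‖ = 1) (hδ : 0 < δ) (hκ : 0 ≤ κ) (hθ : 0 ≤ θ) {z : ℂ}
    (hz : z ∈ ball (0 : ℂ) 1) :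
    -(Real.exp κ * (4 + 2 * (∑ j, |α j|) + 2 * poissonSum η α z) *
      Real.exp (logWeight η α z)) ≤ testLaplacian η α θ κ δ z := by
  set w := 1 - ‖z‖ ^ 2 with hw
  set A := ∑ j, |α j| with hA
  set S := poissonSum η α z with hS
  have hw0 : 0 < w := one_sub_sq_pos hz
  have hw1 : w ≤ 1 := by rw [hw]; nlinarith [norm_nonneg z]
  have hA0 : 0 ≤ A := Finset.sum_nonneg fun j _ => abs_nonneg _
  have hS0 : 0 ≤ S := poissonSum_nonneg hz
  have hX := (abs_le.1 (abs_re_mul_weightLogDeriv_le (α := α) hη hz)).2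
  have k0 := profileDeriv_nonneg (θ := θ) (κ := κ) hδ w
  have k1 := profileDeriv_le (θ := θ) hδ hκ hw0 hw1
  have k3 := le_profileDeriv₂ (θ := θ) (κ := κ) hδ hw0
  have k4 := radialProfile_nonneg (θ := θ) (κ := κ) (x := w) hδ
  have hq : 0 ≤ θ / w := by positivity
  have k5 : 0 ≤ profileDeriv₂ θ κ δ w := le_trans (by positivity) k3
  have k6 : profileDeriv θ κ δ w ≤ Real.exp κ :=
    k1.trans (mul_le_of_le_one_right (Real.exp_pos _).le (Real.rpow_le_one hw0.le hw1 hθ))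
  have t1 : 0 ≤ profileDeriv₂ θ κ δ w * ‖z‖ ^ 2 := by positivity
  have t3 : 0 ≤ radialProfile θ κ δ w * ‖weightLogDeriv η α z‖ ^ 2 := by positivity
  have t2 : profileDeriv θ κ δ w * (4 + 4 * (z * weightLogDeriv η α z).re) ≤
      Real.exp κ * (4 + 2 * A + 2 * S) := by
    refine (mul_le_mul_of_nonneg_left (show _ ≤ 4 + 2 * A + 2 * S by linarith) k0).trans ?_
    exact mul_le_mul_of_nonneg_right k6 (by positivity)
  rw [testLaplacian, ← neg_mul]
  exact mul_le_mul_of_nonneg_right (by linarith) (Real.exp_pos _).le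

theorem one_sub_sq_le_two_mul {z a : ℂ} (hz : z ∈ ball (0 : ℂ) 1) (ha : ‖a‖ = 1) :
    1 - ‖z‖ ^ 2 ≤ 2 * ‖z - a‖ := by
  rw [mem_ball_zero_iff] at hz
  have : ‖a‖ - ‖z‖ ≤ ‖z - a‖ := by
    rw [norm_sub_rev]
    exact norm_sub_norm_le a z
  rw [ha] at this
  nlinarith [norm_nonneg z]

/-- At most one `ηᵢ` lies within `d / 2` of `z`. For it the quotient is at most `4 / (1 - |z|²)` and
`-αᵢ ≤ θ / 2`; the remaining quotients are at most `4 / d²`. -/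
theorem sum_negPart_le (hη : ∀ j, ‖η j‖ = 1) (hθ : 0 ≤ θ) (hα : ∀ j, -(θ / 2) ≤ α j) {d : ℝ}
    (hd : 0 < d) (hsep : ∀ i j, i ≠ j → d ≤ ‖η i - η j‖) {z : ℂ} (hz : z ∈ ball (0 : ℂ) 1) :
    ∑ j, -α j * ((1 - ‖z‖ ^ 2) / ‖z - η j‖ ^ 2) ≤
      2 * θ / (1 - ‖z‖ ^ 2) + 4 / d ^ 2 * ∑ j, |α j| := by
  set w := 1 - ‖z‖ ^ 2 with hw
  have hw0 : 0 < w := one_sub_sq_pos hz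
  have hw1 : w ≤ 1 := by rw [hw]; nlinarith [norm_nonneg z]
  have far : ∀ j, d / 2 ≤ ‖z - η j‖ → -α j * (w / ‖z - η j‖ ^ 2) ≤ 4 / d ^ 2 * |α j| := by
    intro j hj
    have h1 : w / ‖z - η j‖ ^ 2 ≤ 4 / d ^ 2 := by
      have : 4 / d ^ 2 = 1 / (d / 2) ^ 2 := by field_simp; norm_num
      rw [this]
      gcongr
    calc -α j * (w / ‖z - η j‖ ^ 2) ≤ |α j| * (w / ‖z - η j‖ ^ 2) :=
          mul_le_mul_of_nonneg_right (neg_le_abs _) (by positivity)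
      _ ≤ |α j| * (4 / d ^ 2) := mul_le_mul_of_nonneg_left h1 (abs_nonneg _)
      _ = _ := mul_comm _ _
  rw [Finset.mul_sum]
  by_cases hnear : ∃ i, ‖z - η i‖ < d / 2
  · obtain ⟨i, hi⟩ := hnear
    rw [← Finset.add_sum_erase _ _ (Finset.mem_univ i),
      ← Finset.add_sum_erase _ (fun j => 4 / d ^ 2 * |α j|) (Finset.mem_univ i)]
    have hpos : 0 < ‖z - η i‖ := norm_pos_iff.2 (sub_ne_zero_of_mem_ball hz (hη i))
    have h1 : -α i * (w / ‖z - η i‖ ^ 2) ≤ 2 * θ / w := by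
      have h2 : w / ‖z - η i‖ ^ 2 ≤ 4 / w := by
        rw [div_le_div_iff₀ (by positivity) hw0]
        nlinarith [one_sub_sq_le_two_mul hz (hη i)]
      calc -α i * (w / ‖z - η i‖ ^ 2) ≤ θ / 2 * (w / ‖z - η i‖ ^ 2) :=
            mul_le_mul_of_nonneg_right (by linarith [hα i]) (by positivity)
        _ ≤ θ / 2 * (4 / w) := mul_le_mul_of_nonneg_left h2 (by positivity)
        _ = _ := by ring
    have h2 : ∑ j ∈ Finset.univ.erase i, -α j * (w / ‖z - η j‖ ^ 2) ≤
        ∑ j ∈ Finset.univ.erase i, 4 / d ^ 2 * |α j| := by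
      refine Finset.sum_le_sum fun j hj => far j ?_
      have h3 := hsep j i (Finset.ne_of_mem_erase hj)
      have h4 : ‖η j - η i‖ ≤ ‖z - η i‖ + ‖z - η j‖ := by
        rw [show η j - η i = (z - η i) - (z - η j) by ring]
        exact norm_sub_le _ _
      linarith
    have h3 : 0 ≤ 4 / d ^ 2 * |α i| := by positivity
    linarith
  · push Not at hnear
    have h1 := Finset.sum_le_sum fun j (_ : j ∈ Finset.univ) => far j (hnear j)
    have : 0 ≤ 2 * θ / w := by positivity
    linarith

/-- Negative exponents cost at most `θ / w` in the real part, with `w = 1 - |z|²`. This is exactly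
the gain from differentiating `x ^ θ`, whence the condition `αⱼ ≥ -θ / 2`. The bounded remainders
are beaten by `κ`. -/
theorem testLaplacian_nonneg (hη : ∀ j, ‖η j‖ = 1) (hδ : 0 < δ) (hθ : 0 ≤ θ)
    (hα : ∀ j, -(θ / 2) ≤ α j) {d : ℝ} (hd : 0 < d) (hsep : ∀ i j, i ≠ j → d ≤ ‖η i - η j‖)
    (hκ : 2 * θ + 2 + (∑ j, |α j|) + 4 / d ^ 2 * ∑ j, |α j| ≤ κ) {z : ℂ}
    (hz : z ∈ ball (0 : ℂ) 1) (hz2 : 1 - ‖z‖ ^ 2 ≤ 1 / 2) :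
    0 ≤ testLaplacian η α θ κ δ z := by
  have hn := sum_negPart_le hη hθ hα hd hsep hz
  set w := 1 - ‖z‖ ^ 2 with hw
  set A := ∑ j, |α j| with hA
  have hw0 : 0 < w := one_sub_sq_pos hz
  have hX : (z * weightLogDeriv η α z).re ≤ A / 2 + (2 * θ / w + 4 / d ^ 2 * A) / 2 := by
    have h1 : (z * weightLogDeriv η α z).re =
        (∑ j, α j) / 2 + (∑ j, -α j * (w / ‖z - η j‖ ^ 2)) / 2 := by
      rw [re_mul_weightLogDeriv hη hz, ← add_div, ← Finset.sum_add_distrib, Finset.sum_div]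
      refine Finset.sum_congr rfl fun j _ => ?_
      ring
    have h2 : ∑ j, α j ≤ A := Finset.sum_le_sum fun j _ => le_abs_self _
    linarith
  have hA0 : 0 ≤ A := Finset.sum_nonneg fun j _ => abs_nonneg _
  have hq : 0 ≤ 4 / d ^ 2 * A := by positivity
  have k0 := profileDeriv_nonneg (θ := θ) (κ := κ) hδ w
  have k3 := le_profileDeriv₂ (θ := θ) (κ := κ) hδ hw0
  have k4 := radialProfile_nonneg (θ := θ) (κ := κ) (x := w) hδ
  have t3 : 0 ≤ radialProfile θ κ δ w * ‖weightLogDeriv η α z‖ ^ 2 := by positivity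
  have hz3 : ‖z‖ ^ 2 = 1 - w := by rw [hw]; ring
  have t1 : (κ + θ / w) * profileDeriv θ κ δ w * ‖z‖ ^ 2 ≤ profileDeriv₂ θ κ δ w * ‖z‖ ^ 2 :=
    mul_le_mul_of_nonneg_right k3 (by positivity)
  have t2 : 0 ≤ profileDeriv θ κ δ w *
      (4 * ((κ + θ / w) * ‖z‖ ^ 2) - 4 - 4 * (z * weightLogDeriv η α z).re) := by
    refine mul_nonneg k0 ?_
    have h1 : (κ + θ / w) * ‖z‖ ^ 2 = κ * (1 - w) + θ / w - θ := by
      rw [hz3]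
      field_simp
      ring
    -- Here `w ≤ 1 / 2` enters; the threshold for `κ` is twice the sum of the bounded terms.
    have h2 : κ / 2 ≤ κ * (1 - w) := by nlinarith
    have h3 : 2 * θ / w = 2 * (θ / w) := by ring
    rw [h1]
    rw [h3] at hX
    linarith
  rw [testLaplacian]
  refine mul_nonneg ?_ (Real.exp_pos _).le
  nlinarith

end

/-! ### Integrability of the majorant, uniformly in `δ`. -/

theorem exists_separation {n : ℕ} {η : Fin n → ℂ} (hinj : Function.Injective η) :
    ∃ d : ℝ, 0 < d ∧ d ≤ 2 ∧ ∀ i j, i ≠ j → d ≤ ‖η i - η j‖ := by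
  obtain ⟨d, hd, h⟩ : ∃ d : ℝ, 0 < d ∧ ∀ p : Fin n × Fin n, p.1 ≠ p.2 → d ≤ ‖η p.1 - η p.2‖ := by
    have h : ∀ p : Fin n × Fin n, ∃ d : ℝ, 0 < d ∧ (p.1 ≠ p.2 → d ≤ ‖η p.1 - η p.2‖) := by
      intro p
      by_cases hp : p.1 = p.2
      · exact ⟨1, one_pos, fun h => absurd hp h⟩
      · exact ⟨_, norm_pos_iff.2 (sub_ne_zero.2 fun h => hp (hinj h)), fun _ => le_rfl⟩
    choose D hD hD' using h
    by_cases hne : Nonempty (Fin n × Fin n)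
    · obtain ⟨p, hp⟩ := Finite.exists_min D
      exact ⟨D p, hD p, fun q hq => (hp q).trans (hD' q hq)⟩
    · exact ⟨1, one_pos, fun p => absurd ⟨p⟩ hne⟩
  exact ⟨min d 2, lt_min hd two_pos, min_le_right _ _, fun i j hij =>
    (min_le_left _ _).trans (h (i, j) hij)⟩

/-- Near any point at most one factor is large, so the product of singularities is controlled by
their sum. The bound `d ≤ 2` gives `b ≥ 1`. -/
theorem exists_prod_rpow_le {n : ℕ} {η : Fin n → ℂ}
    (hinj : Function.Injective η) {σ : ℝ} (hσ : 0 ≤ σ) : ∃ C : ℝ, 0 < C ∧ ∀ z : ℂ,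
      ∏ j, ‖z - η j‖ ^ (-σ) ≤ C * (1 + ∑ j, ‖z - η j‖ ^ (-σ)) := by
  obtain ⟨d, hd, hd2, hsep⟩ := exists_separation hinj
  set b := (d / 2) ^ (-σ) with hb
  have hb1 : 1 ≤ b := Real.one_le_rpow_of_pos_of_le_one_of_nonpos (by positivity) (by linarith)
    (by linarith)
  have far : ∀ z : ℂ, ∀ j, d / 2 ≤ ‖z - η j‖ → ‖z - η j‖ ^ (-σ) ≤ b := fun z j h =>
    Real.rpow_le_rpow_of_nonpos (by positivity) h (by linarith)
  refine ⟨b ^ n, by positivity, fun z => ?_⟩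
  have hsum : 0 ≤ ∑ j, ‖z - η j‖ ^ (-σ) := Finset.sum_nonneg fun j _ => by positivity
  by_cases hnear : ∃ i, ‖z - η i‖ < d / 2
  · obtain ⟨i, hi⟩ := hnear
    rw [← Finset.mul_prod_erase _ _ (Finset.mem_univ i)]
    have h1 : ∏ j ∈ Finset.univ.erase i, ‖z - η j‖ ^ (-σ) ≤ b ^ n := by
      calc ∏ j ∈ Finset.univ.erase i, ‖z - η j‖ ^ (-σ) ≤ ∏ j ∈ Finset.univ.erase i, b := by
            refine Finset.prod_le_prod (fun j _ => by positivity) fun j hj => far z j ?_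
            have h3 := hsep j i (Finset.ne_of_mem_erase hj)
            have h4 : ‖η j - η i‖ ≤ ‖z - η i‖ + ‖z - η j‖ := by
              rw [show η j - η i = (z - η i) - (z - η j) by ring]
              exact norm_sub_le _ _
            linarith
        _ ≤ b ^ n := by
            rw [Finset.prod_const]
            exact pow_le_pow_right₀ hb1 ((Finset.card_le_univ _).trans (by simp))
    have h2 : ‖z - η i‖ ^ (-σ) ≤ ∑ j, ‖z - η j‖ ^ (-σ) :=
      Finset.single_le_sum (f := fun j => ‖z - η j‖ ^ (-σ)) (fun j _ => by positivity)
        (Finset.mem_univ i)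
    rw [mul_comm (b ^ n)]
    exact mul_le_mul (by linarith) h1 (Finset.prod_nonneg fun j _ => by positivity) (by linarith)
  · push Not at hnear
    calc ∏ j, ‖z - η j‖ ^ (-σ) ≤ ∏ j : Fin n, b :=
          Finset.prod_le_prod (fun j _ => by positivity) fun j _ => far z j (hnear j)
      _ = b ^ n * 1 := by simp
      _ ≤ _ := mul_le_mul_of_nonneg_left (by linarith) (by positivity)

/-- `x ^ (τ - 1)` plus the derivative of the cutoff factor. -/
noncomputable def radialMajorant (τ δ x : ℝ) : ℝ := x ^ (τ - 1) + cutoffDeriv δ x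

theorem radialMajorant_nonneg {τ δ x : ℝ} (hδ : 0 < δ) (hx : 0 < x) : 0 ≤ radialMajorant τ δ x :=
  add_nonneg (by positivity) (cutoffDeriv_nonneg hδ hx)

theorem hasDerivAt_cutoff {δ x : ℝ} (hx : 0 < x) :
    HasDerivAt (fun x => max (x - δ) 0 ^ 2 / x ^ 2) (cutoffDeriv δ x) x := by
  refine ((hasDerivAt_max_sq δ x).fun_div ((hasDerivAt_id x).fun_pow 2)
    (by simpa using hx.ne')).congr_deriv ?_
  rw [cutoffDeriv]
  simp only [id]
  rcases le_total x δ with h | h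
  · rw [max_eq_right (by linarith)]
    simp
  · rw [max_eq_left (by linarith)]
    field_simp
    ring

theorem continuous_cutoff {δ : ℝ} (hδ : 0 < δ) :
    Continuous fun x : ℝ => max (x - δ) 0 ^ 2 / x ^ 2 := by
  -- The numerator vanishes for `x ≤ δ`, so the denominator may be kept away from zero there.
  have h : (fun x : ℝ => max (x - δ) 0 ^ 2 / x ^ 2) =
      fun x => max (x - δ) 0 ^ 2 / max x δ ^ 2 := by
    ext x
    rcases le_total x δ with h | h
    · rw [max_eq_right (by linarith)]
      simp
    · rw [max_eq_left h]
  rw [h]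
  refine Continuous.div (by fun_prop) (by fun_prop) fun x => ?_
  have : 0 < max x δ := lt_max_of_lt_right hδ
  positivity

/-- The integrand has the explicit antiderivative `Y`. The cutoff part of `Y` takes values between
`-1/2` and `0` on the interval, so the bound does not depend on `δ`. -/
theorem lintegral_radialMajorant_le {τ δ : ℝ} (hτ : 0 < τ) (hδ : 0 < δ) :
    ∫⁻ r in Ioo (0 : ℝ) 1, ENNReal.ofReal (r * radialMajorant τ δ (1 - r ^ 2)) ≤
      ENNReal.ofReal (1 / τ + 1) := by
  set Y : ℝ → ℝ := fun r => -(1 / 2) * ((1 - r ^ 2) ^ τ / τ +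
    max ((1 - r ^ 2) - δ) 0 ^ 2 / (1 - r ^ 2) ^ 2) with hY
  have hx : ∀ r ∈ Ioo (0 : ℝ) 1, 0 < 1 - r ^ 2 := fun r hr => by nlinarith [hr.1, hr.2]
  have hc : ContinuousOn Y (Icc 0 1) := by
    refine Continuous.continuousOn (continuous_const.mul (Continuous.add ?_ ?_))
    · exact ((by fun_prop : Continuous fun r : ℝ => 1 - r ^ 2).rpow_const
        fun r => Or.inr hτ.le).div_const τ
    · exact (continuous_cutoff hδ).comp (by fun_prop : Continuous fun r : ℝ => 1 - r ^ 2)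
  have hd : ∀ r ∈ Ioo (0 : ℝ) 1, HasDerivAt Y (r * radialMajorant τ δ (1 - r ^ 2)) r := by
    intro r hr
    have h1 : HasDerivAt (fun r : ℝ => 1 - r ^ 2) (-(2 * r)) r := by
      simpa using (hasDerivAt_pow 2 r).const_sub 1
    have h2 : HasDerivAt (fun x : ℝ => x ^ τ / τ + max (x - δ) 0 ^ 2 / x ^ 2)
        (radialMajorant τ δ (1 - r ^ 2)) (1 - r ^ 2) := by
      refine (((Real.hasDerivAt_rpow_const (p := τ) (Or.inl (hx r hr).ne')).div_const τ).fun_add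
        (hasDerivAt_cutoff (hx r hr))).congr_deriv ?_
      rw [radialMajorant]
      field_simp
    refine ((h2.comp r h1).const_mul (-(1 / 2))).congr_deriv ?_
    ring
  have hp : ∀ r ∈ Ioo (0 : ℝ) 1, 0 ≤ r * radialMajorant τ δ (1 - r ^ 2) := fun r hr =>
    mul_nonneg hr.1.le (radialMajorant_nonneg hδ (hx r hr))
  have hint := intervalIntegral.integrableOn_deriv_of_nonneg hc hd hp
  have hval := intervalIntegral.integral_eq_sub_of_hasDerivAt_of_le zero_le_one hc hd
    ((intervalIntegrable_iff_integrableOn_Ioc_of_le zero_le_one).2 hint)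
  rw [intervalIntegral.integral_of_le zero_le_one, integral_Ioc_eq_integral_Ioo] at hval
  rw [← ofReal_integral_eq_lintegral_ofReal (hint.mono_set Ioo_subset_Ioc_self)
    ((ae_restrict_iff' measurableSet_Ioo).2 (Eventually.of_forall hp)), hval]
  refine ENNReal.ofReal_le_ofReal ?_
  simp only [hY]
  have h1 : max ((1 : ℝ) - δ) 0 ^ 2 ≤ 1 := pow_le_one₀ (le_max_right _ _)
    (max_le (by linarith) zero_le_one)
  have h2 : max (-δ) 0 = 0 := max_eq_right (by linarith)
  have h3 : (0 : ℝ) < τ⁻¹ := by positivity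
  norm_num [hτ.ne', h2]
  linarith

/-- `|r e^{it} - 1| ≥ |e^{it} - 1| / 2 ≥ |t| / π`, the last step by Jordan's inequality for the
sine. This separates the variables `r` and `t`. -/
theorem rpow_norm_sub_one_le {σ : ℝ} (hσ : 0 ≤ σ) {r t : ℝ} (hr0 : 0 < r) (hr1 : r < 1)
    (ht : t ∈ Ioo (-Real.pi) Real.pi) (ht0 : t ≠ 0) :
    ‖(r : ℂ) * (Real.cos t + Real.sin t * Complex.I) - 1‖ ^ (-σ) ≤ Real.pi ^ σ * |t| ^ (-σ) := by
  set e : ℂ := Real.cos t + Real.sin t * Complex.I with he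
  have hexp : e = Complex.exp (Complex.I * t) := by
    rw [he, mul_comm Complex.I, Complex.exp_mul_I]
    simp
  have hen : ‖e‖ = 1 := by rw [hexp, mul_comm, Complex.norm_exp_ofReal_mul_I]
  have h1 : ‖e - 1‖ ≤ 2 * ‖r * e - 1‖ := by
    have h2 : ‖e - 1‖ ≤ ‖r * e - 1‖ + ‖(1 - r) * e‖ := by
      rw [show e - 1 = (r * e - 1) + (1 - r) * e by ring]
      exact norm_add_le _ _
    have h3 : ‖((1 : ℂ) - r) * e‖ = 1 - r := by
      rw [norm_mul, hen, mul_one, ← Complex.ofReal_one, ← Complex.ofReal_sub, Complex.norm_real,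
        Real.norm_eq_abs, abs_of_pos (by linarith)]
    have h4 : 1 - r ≤ ‖r * e - 1‖ := by
      have := norm_sub_norm_le (1 : ℂ) (r * e)
      rw [norm_one, norm_mul, hen, mul_one, Complex.norm_real, Real.norm_eq_abs,
        abs_of_pos hr0, norm_sub_rev] at this
      exact this
    linarith
  have h2 : 2 * (|t| / Real.pi) ≤ ‖e - 1‖ := by
    rw [hexp, Complex.norm_exp_I_mul_ofReal_sub_one, Real.norm_eq_abs, abs_mul, abs_two]
    have h3 := Real.mul_abs_le_abs_sin (x := t / 2) (by
      rw [abs_div, abs_two]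
      have := abs_lt.2 ht
      linarith)
    rw [abs_div, abs_two] at h3
    calc 2 * (|t| / Real.pi) = 2 * (2 / Real.pi * (|t| / 2)) := by ring
      _ ≤ _ := by linarith
  have hpi := Real.pi_pos
  have ht' : 0 < |t| := abs_pos.2 ht0
  calc ‖(r : ℂ) * e - 1‖ ^ (-σ) ≤ (|t| / Real.pi) ^ (-σ) :=
        Real.rpow_le_rpow_of_nonpos (by positivity) (by linarith) (by linarith)
    _ = Real.pi ^ σ * |t| ^ (-σ) := by
        rw [Real.div_rpow ht'.le hpi.le, Real.rpow_neg hpi.le, div_inv_eq_mul, mul_comm]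

theorem lintegral_abs_rpow_lt_top {σ : ℝ} (hσ1 : σ < 1) :
    ∫⁻ t in Ioo (-Real.pi) Real.pi, ENNReal.ofReal (Real.pi ^ σ * |t| ^ (-σ)) < ⊤ := by
  have h1 : IntervalIntegrable (fun t : ℝ => |t| ^ (-σ)) volume 0 Real.pi := by
    refine (intervalIntegral.intervalIntegrable_rpow' (r := -σ) (by linarith)).congr ?_
    intro t ht
    rw [uIoc_of_le Real.pi_pos.le] at ht
    simp only [abs_of_pos ht.1]
  have h2 : IntervalIntegrable (fun t : ℝ => |t| ^ (-σ)) volume (-Real.pi) 0 := by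
    have := (IntervalIntegrable.iff_comp_neg (h := enorm_ne_top)).1 h1
    simpa using this.symm
  have h3 := ((h2.trans h1).const_mul (Real.pi ^ σ))
  rw [intervalIntegrable_iff_integrableOn_Ioo_of_le (by linarith [Real.pi_pos])] at h3
  exact h3.lintegral_lt_top

theorem exists_lintegral_majorant_le {σ τ : ℝ} (hσ : 0 ≤ σ) (hσ1 : σ < 1) (hτ : 0 < τ) :
    ∃ C : ENNReal, C < ⊤ ∧ ∀ δ > 0, ∀ a : ℂ, ‖a‖ = 1 → ∫⁻ z in ball (0 : ℂ) 1,
      ENNReal.ofReal (radialMajorant τ δ (1 - ‖z‖ ^ 2) * ‖z - a‖ ^ (-σ)) ≤ C := by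
  refine ⟨ENNReal.ofReal (1 / τ + 1) *
    ∫⁻ t in Ioo (-Real.pi) Real.pi, ENNReal.ofReal (Real.pi ^ σ * |t| ^ (-σ)),
    ENNReal.mul_lt_top ENNReal.ofReal_lt_top (lintegral_abs_rpow_lt_top hσ1), fun δ hδ a ha => ?_⟩
  have hrot : ∫⁻ z in ball (0 : ℂ) 1,
      ENNReal.ofReal (radialMajorant τ δ (1 - ‖z‖ ^ 2) * ‖z - a‖ ^ (-σ)) =
      ∫⁻ z in ball (0 : ℂ) 1,
        ENNReal.ofReal (radialMajorant τ δ (1 - ‖z‖ ^ 2) * ‖z - 1‖ ^ (-σ)) := by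
    -- A rotation moves the singular point to `1` and preserves the radial factor.
    obtain ⟨c, rfl⟩ : ∃ c : Circle, (c : ℂ) = a := ⟨⟨a, mem_sphere_zero_iff_norm.2 ha⟩, rfl⟩
    have hpre : (rotation c) ⁻¹' ball (0 : ℂ) 1 = ball (0 : ℂ) 1 := by
      ext z
      rw [mem_preimage, mem_ball_zero_iff, mem_ball_zero_iff, LinearIsometryEquiv.norm_map]
    rw [← (rotation c).measurePreserving.setLIntegral_comp_preimage_emb
      (rotation c).toHomeomorph.measurableEmbedding, hpre]
    refine lintegral_congr fun z => ?_
    rw [LinearIsometryEquiv.norm_map, rotation_apply,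
      show (c : ℂ) * z - c = c * (z - 1) by ring, norm_mul, ha, one_mul]
  rw [hrot, ← lintegral_indicator measurableSet_ball, ← Complex.lintegral_comp_polarCoord_symm,
    polarCoord_target, ← lintegral_indicator (measurableSet_Ioi.prod measurableSet_Ioo)]
  have hm1 : Measurable fun r : ℝ => ENNReal.ofReal (r * radialMajorant τ δ (1 - r ^ 2)) := by
    unfold radialMajorant cutoffDeriv
    fun_prop
  have hm2 : Measurable fun t : ℝ => ENNReal.ofReal (Real.pi ^ σ * |t| ^ (-σ)) := by
    fun_prop
  calc _ ≤ ∫⁻ p : ℝ × ℝ, (Ioo (0 : ℝ) 1).indicator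
          (fun r => ENNReal.ofReal (r * radialMajorant τ δ (1 - r ^ 2))) p.1 *
        (Ioo (-Real.pi) Real.pi).indicator
          (fun t => ENNReal.ofReal (Real.pi ^ σ * |t| ^ (-σ))) p.2 := by
        refine lintegral_mono_ae ?_
        -- At `t = 0` the default `0 ^ (-σ) = 0` for `σ ≠ 0` would spoil the pointwise bound.
        have h0 : ∀ᵐ t : ℝ, t ≠ 0 := Measure.ae_ne volume 0
        filter_upwards [Measure.quasiMeasurePreserving_snd.ae h0] with p hp
        by_cases hpm : p ∈ Ioi (0 : ℝ) ×ˢ Ioo (-Real.pi) Real.pi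
        swap
        · rw [indicator_of_notMem hpm]
          exact zero_le
        have hr0 : 0 < p.1 := hpm.1
        have hnorm : ‖(p.1 : ℂ) * (Real.cos p.2 + Real.sin p.2 * Complex.I)‖ = p.1 := by
          rw [norm_mul, Complex.norm_real, Complex.ofReal_cos, Complex.ofReal_sin,
            Complex.norm_cos_add_sin_mul_I, mul_one, Real.norm_eq_abs, abs_of_pos hr0]
        rw [indicator_of_mem hpm, Complex.polarCoord_symm_apply]
        by_cases hr1 : p.1 < 1
        · have hw : 0 < 1 - p.1 ^ 2 := by nlinarith
          rw [indicator_of_mem (by rwa [mem_ball_zero_iff, hnorm]),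
            indicator_of_mem (show p.1 ∈ Ioo (0 : ℝ) 1 from ⟨hr0, hr1⟩), indicator_of_mem hpm.2,
            hnorm, smul_eq_mul, ← ENNReal.ofReal_mul hr0.le, ← ENNReal.ofReal_mul
              (mul_nonneg hr0.le (radialMajorant_nonneg hδ hw)), mul_assoc]
          refine ENNReal.ofReal_le_ofReal (mul_le_mul_of_nonneg_left
            (mul_le_mul_of_nonneg_left ?_ (radialMajorant_nonneg hδ hw)) hr0.le)
          exact rpow_norm_sub_one_le hσ hr0 hr1 hpm.2 hp
        · rw [indicator_of_notMem (by rwa [mem_ball_zero_iff, hnorm]), smul_zero]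
          exact zero_le
    _ = (∫⁻ r in Ioo (0 : ℝ) 1, ENNReal.ofReal (r * radialMajorant τ δ (1 - r ^ 2))) *
        ∫⁻ t in Ioo (-Real.pi) Real.pi, ENNReal.ofReal (Real.pi ^ σ * |t| ^ (-σ)) := by
        rw [Measure.volume_eq_prod, lintegral_prod_mul
          (hm1.indicator measurableSet_Ioo).aemeasurable
          (hm2.indicator measurableSet_Ioo).aemeasurable,
          lintegral_indicator measurableSet_Ioo, lintegral_indicator measurableSet_Ioo]
    _ ≤ _ := mul_le_mul_left (lintegral_radialMajorant_le hτ hδ) _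

theorem exists_integral_majorant_le {n : ℕ} {η : Fin n → ℂ} (hη : ∀ j, ‖η j‖ = 1)
    (hinj : Function.Injective η) {σ τ : ℝ} (hσ : 0 ≤ σ) (hσ1 : σ < 1) (hτ : 0 < τ) :
    ∃ C : ℝ, 0 ≤ C ∧ ∀ δ > 0,
      IntegrableOn (fun z => radialMajorant τ δ (1 - ‖z‖ ^ 2) * ∏ j, ‖z - η j‖ ^ (-σ))
        (ball 0 1) ∧
      ∫ z in ball 0 1, radialMajorant τ δ (1 - ‖z‖ ^ 2) * ∏ j, ‖z - η j‖ ^ (-σ) ≤ C := by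
  obtain ⟨C₁, hC₁, hprod⟩ := exists_prod_rpow_le hinj hσ
  obtain ⟨C₂, hC₂, h2⟩ := exists_lintegral_majorant_le hσ hσ1 hτ
  -- The exponent `0` handles the summand `1` in `exists_prod_rpow_le`.
  obtain ⟨C₃, hC₃, h3⟩ := exists_lintegral_majorant_le le_rfl zero_lt_one hτ
  set C := ENNReal.ofReal C₁ * (C₃ + ∑ _j : Fin n, C₂) with hC
  have hCtop : C < ⊤ := by
    refine ENNReal.mul_lt_top ENNReal.ofReal_lt_top (ENNReal.add_lt_top.2 ⟨hC₃, ?_⟩)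
    exact ENNReal.sum_lt_top.2 fun _ _ => hC₂
  refine ⟨C.toReal, ENNReal.toReal_nonneg, fun δ hδ => ?_⟩
  have hm : Measurable fun z : ℂ => radialMajorant τ δ (1 - ‖z‖ ^ 2) := by
    unfold radialMajorant cutoffDeriv
    fun_prop
  have hmp : Measurable fun z : ℂ =>
      radialMajorant τ δ (1 - ‖z‖ ^ 2) * ∏ j, ‖z - η j‖ ^ (-σ) := by
    fun_prop
  have hpos : ∀ z ∈ ball (0 : ℂ) 1,
      0 ≤ radialMajorant τ δ (1 - ‖z‖ ^ 2) * ∏ j, ‖z - η j‖ ^ (-σ) := fun z hz =>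
    mul_nonneg (radialMajorant_nonneg hδ (one_sub_sq_pos hz))
      (Finset.prod_nonneg fun j _ => by positivity)
  have hae : ∀ᵐ z ∂volume.restrict (ball (0 : ℂ) 1),
      0 ≤ radialMajorant τ δ (1 - ‖z‖ ^ 2) * ∏ j, ‖z - η j‖ ^ (-σ) :=
    (ae_restrict_iff' measurableSet_ball).2 (Eventually.of_forall hpos)
  have hle : ∫⁻ z in ball (0 : ℂ) 1,
      ENNReal.ofReal (radialMajorant τ δ (1 - ‖z‖ ^ 2) * ∏ j, ‖z - η j‖ ^ (-σ)) ≤ C := by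
    calc _ ≤ ∫⁻ z in ball (0 : ℂ) 1, ENNReal.ofReal C₁ *
          (ENNReal.ofReal (radialMajorant τ δ (1 - ‖z‖ ^ 2) * ‖z - 1‖ ^ (-0 : ℝ)) +
          ∑ j, ENNReal.ofReal (radialMajorant τ δ (1 - ‖z‖ ^ 2) * ‖z - η j‖ ^ (-σ))) := by
          refine setLIntegral_mono (by fun_prop) fun z hz => ?_
          have hr := radialMajorant_nonneg (τ := τ) hδ (one_sub_sq_pos hz)
          rw [← ENNReal.ofReal_sum_of_nonneg fun j _ => by positivity,
            ← ENNReal.ofReal_add (by positivity) (Finset.sum_nonneg fun j _ => by positivity),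
            ← ENNReal.ofReal_mul hC₁.le, neg_zero, Real.rpow_zero, ← Finset.mul_sum, ← mul_add,
            mul_left_comm]
          exact ENNReal.ofReal_le_ofReal (mul_le_mul_of_nonneg_left (hprod z) hr)
      _ = ENNReal.ofReal C₁ * ((∫⁻ z in ball (0 : ℂ) 1,
            ENNReal.ofReal (radialMajorant τ δ (1 - ‖z‖ ^ 2) * ‖z - 1‖ ^ (-0 : ℝ))) +
          ∑ j, ∫⁻ z in ball (0 : ℂ) 1,
            ENNReal.ofReal (radialMajorant τ δ (1 - ‖z‖ ^ 2) * ‖z - η j‖ ^ (-σ))) := by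
          rw [lintegral_const_mul _ (by fun_prop), lintegral_add_left (by fun_prop),
            lintegral_finsetSum _ fun j _ => by fun_prop]
      _ ≤ C := by
          exact mul_le_mul_right (add_le_add (h3 δ hδ 1 (by simp))
            (Finset.sum_le_sum fun j _ => h2 δ hδ _ (hη j))) _
  constructor
  · refine ⟨hmp.aestronglyMeasurable, ?_⟩
    rw [hasFiniteIntegral_iff_ofReal hae]
    exact hle.trans_lt hCtop
  · rw [integral_eq_lintegral_of_nonneg_ae hae hmp.aestronglyMeasurable]
    exact ENNReal.toReal_mono hCtop.ne hle

/-! ### The general bound for sums over zeros. -/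

section

variable {n : ℕ} {η : Fin n → ℂ} {α : Fin n → ℝ}

theorem quarter_le_norm_sub {z a : ℂ} (hz : ‖z‖ ^ 2 < 1 / 2) (ha : ‖a‖ = 1) :
    1 / 4 ≤ ‖z - a‖ := by
  have h1 : ‖z‖ ≤ 3 / 4 := by nlinarith [norm_nonneg z]
  have h2 := norm_sub_norm_le a z
  rw [ha, norm_sub_rev] at h2
  linarith

theorem norm_sub_le_two {z a : ℂ} (hz : ‖z‖ < 1) (ha : ‖a‖ = 1) : ‖z - a‖ ≤ 2 := by
  have := norm_sub_le z a
  linarith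

theorem abs_logWeight_le (hη : ∀ j, ‖η j‖ = 1) {z : ℂ} (hz : ‖z‖ ^ 2 < 1 / 2) :
    |logWeight η α z| ≤ (∑ j, |α j|) * Real.log 4 := by
  rw [logWeight, Finset.sum_mul]
  refine (Finset.abs_sum_le_sum_abs _ _).trans (Finset.sum_le_sum fun j _ => ?_)
  rw [abs_mul]
  refine mul_le_mul_of_nonneg_left ?_ (abs_nonneg _)
  have h1 := quarter_le_norm_sub hz (hη j)
  have h2 : ‖z - η j‖ ≤ 4 :=
    (norm_sub_le_two (by nlinarith [norm_nonneg z]) (hη j)).trans (by norm_num)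
  rw [abs_le]
  constructor
  · rw [← Real.log_inv]
    exact Real.log_le_log (by norm_num) (by linarith)
  · exact Real.log_le_log (by linarith) h2

theorem poissonSum_le (hη : ∀ j, ‖η j‖ = 1) {z : ℂ} (hz : ‖z‖ ^ 2 < 1 / 2) :
    poissonSum η α z ≤ 16 * ∑ j, |α j| := by
  rw [poissonSum, Finset.mul_sum]
  refine Finset.sum_le_sum fun j _ => ?_
  rw [mul_comm]
  refine mul_le_mul_of_nonneg_right ?_ (abs_nonneg _)
  have h1 := quarter_le_norm_sub hz (hη j)
  rw [div_le_iff₀ (by positivity)]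
  nlinarith [sq_nonneg ‖z‖]

set_option maxHeartbeats 1000000 in
-- `M` is the growth majorant. `hM2` serves the part of the upper bound in `testLaplacian_le`
-- without `cutoffDeriv`; `hM1` serves the `cutoffDeriv` part and the correction in the central
-- disc.
theorem exists_zero_sum_bound (hη : ∀ j, ‖η j‖ = 1) (hinj : Function.Injective η) {θ : ℝ}
    (hθ : 0 ≤ θ) (hα : ∀ j, -(θ / 2) ≤ α j) {σ τ : ℝ} (hσ : 0 ≤ σ) (hσ1 : σ < 1) (hτ : 0 < τ)
    (hτ1 : τ ≤ 1) {M : ℂ → ℝ} (hM0 : ∀ z ∈ ball (0 : ℂ) 1, 0 ≤ M z) {C₁ : ℝ}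
    (hM1 : ∀ z ∈ ball (0 : ℂ) 1, M z * ((1 - ‖z‖ ^ 2) ^ θ * Real.exp (logWeight η α z)) ≤
      C₁ * ∏ j, ‖z - η j‖ ^ (-σ))
    (hM2 : ∀ z ∈ ball (0 : ℂ) 1, M z * ((1 - ‖z‖ ^ 2) ^ θ * Real.exp (logWeight η α z) *
      (1 + θ / (1 - ‖z‖ ^ 2) + poissonSum η α z)) ≤
        C₁ * ((1 - ‖z‖ ^ 2) ^ (τ - 1) * ∏ j, ‖z - η j‖ ^ (-σ))) :
    ∃ C : ℝ, ∀ (D : ℝ) (f : ℂ → ℂ), 0 ≤ D → DifferentiableOn ℂ f (ball 0 1) → ‖f 0‖ = 1 →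
      (∀ z ∈ ball (0 : ℂ) 1, Real.log ‖f z‖ ≤ D * M z) →
      ∀ A : Finset ℂ, (∀ a ∈ A, a ∈ ball (0 : ℂ) 1 ∧ f a = 0) →
        ∑ a ∈ A, analyticOrderNatAt f a *
          ((1 - ‖a‖ ^ 2) ^ (θ + 1) * Real.exp (logWeight η α a)) ≤ D * C := by
  obtain ⟨d, hd, -, hsep⟩ := exists_separation hinj
  obtain ⟨C₂, hC₂, hmaj⟩ := exists_integral_majorant_le hη hinj hσ hσ1 hτ
  set A₀ := ∑ j, |α j| with hA₀
  have hA₀0 : 0 ≤ A₀ := Finset.sum_nonneg fun j _ => abs_nonneg _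
  set κ := 2 * θ + 2 + A₀ + 4 / d ^ 2 * A₀ with hκ
  have hκ0 : 0 ≤ κ := by positivity
  set b := Real.exp (A₀ * Real.log 4) with hb
  -- `34 = 2 + 2 * 16`, from `neg_le_testLaplacian` and the bound `16 * A₀` for `poissonSum` when
  -- `|z|² < 1/2`.
  set K := Real.exp κ * (4 + 34 * A₀) * b with hK
  have hK0 : 0 ≤ K := by positivity
  set L := Real.exp κ * (4 * κ + 6 + 3 * A₀) with hL
  have hL0 : 0 ≤ L := by positivity
  set c₀ := ∫ ζ : ℂ, 2 / (1 + ‖ζ‖ ^ 2) ^ 2 with hc₀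
  have hc₀0 : 0 < c₀ := integral_fubiniStudy_pos
  have hC₁ : 0 ≤ C₁ := by
    have h0 : (0 : ℂ) ∈ ball (0 : ℂ) 1 := mem_ball_self one_pos
    have := hM1 0 h0
    have h1 : 0 < ∏ j, ‖(0 : ℂ) - η j‖ ^ (-σ) := Finset.prod_pos fun j _ => by simp [hη j]
    have h2 : 0 ≤ M 0 * ((1 - ‖(0 : ℂ)‖ ^ 2) ^ θ * Real.exp (logWeight η α 0)) :=
      mul_nonneg (hM0 0 h0) (by simp; positivity)
    exact nonneg_of_mul_nonneg_left (h2.trans this) h1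
  set C' := C₁ * (L + K * 2 ^ θ * b) with hC'
  refine ⟨8 * 2 ^ θ / c₀ * (C' * C₂), fun D f hD hf hf0 hlog A hA => ?_⟩
  -- The cutoff depends on the finite set `A`, whereas the constant was fixed beforehand.
  obtain ⟨δ, hδ0, hδ1, hδA⟩ : ∃ δ : ℝ, 0 < δ ∧ δ ≤ 1 / 4 ∧ ∀ a ∈ A, 4 * δ ≤ 1 - ‖a‖ ^ 2 := by
    have h1 : ∀ᶠ δ : ℝ in 𝓝[>] 0, ∀ a ∈ A, 4 * δ ≤ 1 - ‖a‖ ^ 2 := by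
      refine (Finset.eventually_all A).2 fun a ha => ?_
      have h2 : 0 < (1 - ‖a‖ ^ 2) / 4 := by linarith [one_sub_sq_pos (hA a ha).1]
      filter_upwards [Ioo_mem_nhdsGT h2] with δ hδ
      linarith [hδ.2]
    have h2 : ∀ᶠ δ : ℝ in 𝓝[>] 0, δ ∈ Ioo (0 : ℝ) (1 / 4) := Ioo_mem_nhdsGT (by norm_num)
    obtain ⟨δ, h3, h4⟩ := (h1.and h2).exists
    exact ⟨δ, h4.1, h4.2.le, h3⟩
  obtain ⟨φ₁, φ₂, ψ₁, ψ₂, H1, HI, hoff, hlap⟩ :=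
    exists_testFn_derivs (θ := θ) (κ := κ) (α := α) hη hδ0
  set r := √(1 - δ) with hr
  set R := √(1 / 2 : ℝ) with hR
  have hr2 : r ^ 2 = 1 - δ := Real.sq_sqrt (by linarith)
  have hr0 : 0 < r := Real.sqrt_pos.2 (by linarith)
  have hr1 : r < 1 := by nlinarith
  have hRr : R ≤ r := Real.sqrt_le_sqrt (by linarith)
  have hR2 : R ^ 2 = 1 / 2 := Real.sq_sqrt (by norm_num)
  have hR0 : 0 ≤ R := Real.sqrt_nonneg _
  have hmemr : ∀ z : ℂ, z ∉ closedBall (0 : ℂ) r → 1 - ‖z‖ ^ 2 ≤ δ := by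
    intro z hz
    rw [mem_closedBall_zero_iff, not_le] at hz
    nlinarith
  have hmemR : ∀ z : ℂ, z ∈ ball (0 : ℂ) R ↔ ‖z‖ ^ 2 < 1 / 2 := by
    intro z
    rw [mem_ball_zero_iff, ← hR2]
    exact (pow_lt_pow_iff_left₀ (norm_nonneg z) hR0 two_ne_zero).symm
  have hball : ball (0 : ℂ) R ⊆ ball 0 1 := ball_subset_ball (by linarith)
  have hout : ∀ z ∉ ball (0 : ℂ) 1, φ₂ z + ψ₂ z + (ball (0 : ℂ) R).indicator (fun _ => K) z = 0 := by
    intro z hz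
    have h1 : 1 - ‖z‖ ^ 2 ≤ δ := by
      rw [mem_ball_zero_iff, not_lt] at hz
      nlinarith
    rw [indicator_of_notMem fun h => hz (hball h), (hoff z h1).2.1, (hoff z h1).2.2.2]
    simp
  have hW : ∀ z, 0 ≤ φ₂ z + ψ₂ z + (ball (0 : ℂ) R).indicator (fun _ => K) z := by
    intro z
    by_cases hz : z ∈ ball (0 : ℂ) 1
    swap
    · exact (hout z hz).ge
    rw [hlap z hz]
    by_cases hzR : z ∈ ball (0 : ℂ) R
    · rw [indicator_of_mem hzR]
      have hz2 := (hmemR z).1 hzR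
      have h1 := neg_le_testLaplacian (α := α) hη hδ0 hκ0 hθ hz
      have h2 : Real.exp (logWeight η α z) ≤ b :=
        Real.exp_le_exp.2 ((le_abs_self _).trans (abs_logWeight_le hη hz2))
      have h3 : 4 + 2 * A₀ + 2 * poissonSum η α z ≤ 4 + 34 * A₀ := by
        linarith [poissonSum_le (α := α) hη hz2]
      have h4 : Real.exp κ * (4 + 2 * A₀ + 2 * poissonSum η α z) *
          Real.exp (logWeight η α z) ≤ K := by
        rw [hK]
        gcongr
      linarith
    · rw [indicator_of_notMem hzR, add_zero]
      refine testLaplacian_nonneg hη hδ0 hθ hα hd hsep le_rfl hz ?_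
      rw [hmemR, not_lt] at hzR
      linarith
  have hmain := sum_zeros_le_integral hf hf0 hr0 hr1 H1 HI
    (fun z hz => by simp [radialProfile_of_le hδ0 (hmemr z hz)])
    (fun z hz => (hoff z (hmemr z hz)).1) (fun z hz => (hoff z (hmemr z hz)).2.1)
    (fun z hz => (hoff z (hmemr z hz)).2.2.1) (fun z hz => (hoff z (hmemr z hz)).2.2.2)
    (fun z => mul_nonneg (radialProfile_nonneg hδ0) (Real.exp_pos _).le) hRr hK0 hW A
    (fun a ha => ⟨by
      by_contra h
      have := hmemr a h
      linarith [hδA a ha], (hA a ha).2⟩)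
  have hpt : ∀ z ∈ ball (0 : ℂ) 1,
      max (Real.log ‖f z‖) 0 * (φ₂ z + ψ₂ z + (ball (0 : ℂ) R).indicator (fun _ => K) z) ≤
      D * C' * (radialMajorant τ δ (1 - ‖z‖ ^ 2) * ∏ j, ‖z - η j‖ ^ (-σ)) := by
    intro z hz
    have hw := one_sub_sq_pos hz
    have hMz := hM0 z hz
    set w := 1 - ‖z‖ ^ 2 with hwdef
    set Q := ∏ j, ‖z - η j‖ ^ (-σ) with hQ
    have hQ0 : 0 ≤ Q := Finset.prod_nonneg fun j _ => by positivity
    have hρ := cutoffDeriv_nonneg hδ0 hw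
    have h1 : max (Real.log ‖f z‖) 0 ≤ D * M z := max_le (hlog z hz) (mul_nonneg hD hMz)
    refine (mul_le_mul_of_nonneg_right h1 (hW z)).trans ?_
    rw [mul_assoc, mul_assoc D]
    refine mul_le_mul_of_nonneg_left ?_ hD
    rw [hlap z hz, mul_add]
    have t1 : M z * testLaplacian η α θ κ δ z ≤ L * (C₁ * (radialMajorant τ δ w * Q)) := by
      have h2 := mul_le_mul_of_nonneg_left (testLaplacian_le (α := α) hη hδ0 hκ0 hθ hz) hMz
      have h3 := hM2 z hz
      have h4 := mul_le_mul_of_nonneg_right (hM1 z hz) hρ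
      calc _ ≤ _ := h2
        _ = L * (M z * (w ^ θ * Real.exp (logWeight η α z) *
              (1 + θ / w + poissonSum η α z)) +
            M z * (w ^ θ * Real.exp (logWeight η α z)) * cutoffDeriv δ w) := by rw [hL]; ring
        _ ≤ L * (C₁ * (w ^ (τ - 1) * Q) + C₁ * Q * cutoffDeriv δ w) :=
            mul_le_mul_of_nonneg_left (add_le_add h3 h4) hL0
        _ = _ := by rw [radialMajorant]; ring
    -- In the central disc the weight `w ^ θ exp (logWeight)` is at least `1 / (2 ^ θ b)`, so the
    -- constant `K` is dominated by a multiple of it.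
    have t2 : M z * (ball (0 : ℂ) R).indicator (fun _ => K) z ≤
        K * 2 ^ θ * b * (C₁ * (radialMajorant τ δ w * Q)) := by
      have hrm : 0 ≤ radialMajorant τ δ w := radialMajorant_nonneg hδ0 hw
      by_cases hzR : z ∈ ball (0 : ℂ) R
      swap
      · rw [indicator_of_notMem hzR, mul_zero]
        positivity
      rw [indicator_of_mem hzR]
      have hz2 := (hmemR z).1 hzR
      have h2 : 1 ≤ b * Real.exp (logWeight η α z) := by
        rw [hb, ← Real.exp_add]
        refine Real.one_le_exp ?_
        have := (abs_le.1 (abs_logWeight_le (α := α) hη hz2)).1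
        linarith
      have h3 : 1 ≤ 2 ^ θ * w ^ θ := by
        rw [← Real.mul_rpow zero_le_two hw.le]
        exact Real.one_le_rpow (by linarith) hθ
      have h4 : 1 ≤ radialMajorant τ δ w := by
        have : 1 ≤ w ^ (τ - 1) := Real.one_le_rpow_of_pos_of_le_one_of_nonpos hw
          (by linarith [sq_nonneg ‖z‖]) (by linarith)
        rw [radialMajorant]
        linarith
      have h5 : 1 ≤ (2 ^ θ * w ^ θ) * (b * Real.exp (logWeight η α z)) :=
        one_le_mul_of_one_le_of_one_le h3 h2
      calc M z * K ≤ M z * K * ((2 ^ θ * w ^ θ) * (b * Real.exp (logWeight η α z))) :=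
            le_mul_of_one_le_right (by positivity) h5
        _ = K * 2 ^ θ * b * (M z * (w ^ θ * Real.exp (logWeight η α z))) := by ring
        _ ≤ K * 2 ^ θ * b * (C₁ * Q) := mul_le_mul_of_nonneg_left (hM1 z hz) (by positivity)
        _ ≤ K * 2 ^ θ * b * (C₁ * (radialMajorant τ δ w * Q)) := by
            gcongr
            exact le_mul_of_one_le_left hQ0 h4
    calc _ ≤ _ := add_le_add t1 t2
      _ = _ := by rw [hC']; ring
  have hint : ∫ z, max (Real.log ‖f z‖) 0 *
      (φ₂ z + ψ₂ z + (ball (0 : ℂ) R).indicator (fun _ => K) z) ≤ D * C' * C₂ := by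
    have hg := (hmaj δ hδ0).1.const_mul (D * C')
    calc _ ≤ ∫ z, (ball (0 : ℂ) 1).indicator (fun z => D * C' *
          (radialMajorant τ δ (1 - ‖z‖ ^ 2) * ∏ j, ‖z - η j‖ ^ (-σ))) z := by
          refine integral_mono_of_nonneg
            (Eventually.of_forall fun z => mul_nonneg (le_max_right _ _) (hW z))
            ((integrable_indicator_iff measurableSet_ball).2 hg)
            (Eventually.of_forall fun z => ?_)
          by_cases hz : z ∈ ball (0 : ℂ) 1
          · simp only [indicator_of_mem hz]
            exact hpt z hz
          · simp only [indicator_of_notMem hz, hout z hz, mul_zero, le_refl]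
      _ = D * C' * ∫ z in ball (0 : ℂ) 1,
          radialMajorant τ δ (1 - ‖z‖ ^ 2) * ∏ j, ‖z - η j‖ ^ (-σ) := by
          rw [integral_indicator measurableSet_ball, integral_const_mul]
      _ ≤ D * C' * C₂ := mul_le_mul_of_nonneg_left (hmaj δ hδ0).2 (by positivity)
  have hfinal := hmain.trans hint
  have hlow : ∑ a ∈ A, analyticOrderNatAt f a *
      ((1 - ‖a‖ ^ 2) ^ (θ + 1) * Real.exp (logWeight η α a)) ≤
      8 * 2 ^ θ * ∑ a ∈ A, analyticOrderNatAt f a *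
        (radialProfile θ κ δ (1 - ‖a‖ ^ 2) * Real.exp (logWeight η α a)) := by
    rw [Finset.mul_sum]
    refine Finset.sum_le_sum fun a ha => ?_
    have hw := one_sub_sq_pos (hA a ha).1
    have h1 := le_radialProfile (θ := θ) hδ0 hκ0 hθ (hδA a ha)
    -- The factor `8 * 2 ^ θ` undoes the constants lost in `le_radialProfile`.
    have h2 : (1 - ‖a‖ ^ 2) ^ (θ + 1) = 8 * 2 ^ θ *
        (((1 - ‖a‖ ^ 2) / 2) ^ θ / 4 * ((1 - ‖a‖ ^ 2) / 2)) := by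
      rw [Real.rpow_add_one hw.ne', Real.div_rpow hw.le zero_le_two]
      field_simp
      norm_num
    rw [h2]
    calc _ = (analyticOrderNatAt f a : ℝ) * (8 * 2 ^ θ *
          (((1 - ‖a‖ ^ 2) / 2) ^ θ / 4 * ((1 - ‖a‖ ^ 2) / 2) *
            Real.exp (logWeight η α a))) := by ring
      _ ≤ (analyticOrderNatAt f a : ℝ) * (8 * 2 ^ θ * (radialProfile θ κ δ (1 - ‖a‖ ^ 2) *
            Real.exp (logWeight η α a))) := by gcongr
      _ = _ := by ring
  refine hlow.trans ?_
  calc _ ≤ 8 * 2 ^ θ * (D * C' * C₂ / c₀) := by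
        refine mul_le_mul_of_nonneg_left ?_ (by positivity)
        rw [le_div_iff₀ hc₀0, mul_comm]
        exact hfinal
    _ = _ := by ring

end

/-! ### The two growth regimes. -/

theorem zeroSumLE_of_finset_bound {f : ℂ → ℂ} {w : ℂ → ℝ} {B : ℝ}
    (hw : ∀ a ∈ zeroSet f, 0 ≤ w a)
    (h : ∀ A : Finset ℂ, (∀ a ∈ A, a ∈ ball (0 : ℂ) 1 ∧ f a = 0) →
      ∑ a ∈ A, analyticOrderNatAt f a * w a ≤ B) : ZeroSumLE f w B := by
  have h0 : 0 ≤ fun a : zeroSet f => (analyticOrderNatAt f (a : ℂ) : ℝ) * w a := fun a =>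
    mul_nonneg (Nat.cast_nonneg _) (hw a a.2)
  have h1 : ∀ u : Finset (zeroSet f),
      ∑ a ∈ u, (analyticOrderNatAt f (a : ℂ) : ℝ) * w a ≤ B := fun u => by
    have := h (u.map (Function.Embedding.subtype _)) (fun a ha => by
      obtain ⟨b, -, rfl⟩ := Finset.mem_map.1 ha
      exact b.2)
    rwa [Finset.sum_map] at this
  exact ⟨summable_of_sum_le h0 h1, Real.tsum_le_of_sum_le h0 h1⟩

/-- The product `∏ⱼ |z - ηⱼ| ^ αⱼ`. -/
noncomputable def normProd {n : ℕ} (η : Fin n → ℂ) (α : Fin n → ℝ) (z : ℂ) : ℝ :=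
  ∏ j, ‖z - η j‖ ^ α j

section

variable {n : ℕ} {η : Fin n → ℂ} {α β q : Fin n → ℝ} {z : ℂ}

theorem norm_sub_pos (hη : ∀ j, ‖η j‖ = 1) (hz : z ∈ ball (0 : ℂ) 1) (j : Fin n) :
    0 < ‖z - η j‖ := norm_pos_iff.2 (sub_ne_zero_of_mem_ball hz (hη j))

theorem normProd_pos (hη : ∀ j, ‖η j‖ = 1) (hz : z ∈ ball (0 : ℂ) 1) : 0 < normProd η α z :=
  Finset.prod_pos fun j _ => Real.rpow_pos_of_pos (norm_sub_pos hη hz j) _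

theorem exp_logWeight (hη : ∀ j, ‖η j‖ = 1) (hz : z ∈ ball (0 : ℂ) 1) :
    Real.exp (logWeight η α z) = normProd η α z := by
  rw [logWeight, Real.exp_sum, normProd]
  refine Finset.prod_congr rfl fun j _ => ?_
  rw [Real.rpow_def_of_pos (norm_sub_pos hη hz j), mul_comm]

theorem normProd_add (hη : ∀ j, ‖η j‖ = 1) (hz : z ∈ ball (0 : ℂ) 1) :
    normProd η (fun j => α j + β j) z = normProd η α z * normProd η β z := by
  rw [normProd, normProd, normProd, ← Finset.prod_mul_distrib]
  exact Finset.prod_congr rfl fun j _ => Real.rpow_add (norm_sub_pos hη hz j) _ _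

theorem normProd_div (hη : ∀ j, ‖η j‖ = 1) (hz : z ∈ ball (0 : ℂ) 1) :
    normProd η α z / normProd η q z = normProd η (fun j => α j - q j) z := by
  rw [normProd, normProd, normProd, ← Finset.prod_div_distrib]
  exact Finset.prod_congr rfl fun j _ => (Real.rpow_sub (norm_sub_pos hη hz j) _ _).symm

/-- In the disc `|z - ηⱼ| ≤ 2`, so lowering an exponent costs only a power of `2`. -/
theorem normProd_le (hη : ∀ j, ‖η j‖ = 1) (hz : z ∈ ball (0 : ℂ) 1) (h : ∀ j, β j ≤ α j) :
    normProd η α z ≤ (∏ j, (2 : ℝ) ^ (α j - β j)) * normProd η β z := by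
  rw [normProd, normProd, ← Finset.prod_mul_distrib]
  refine Finset.prod_le_prod (fun j _ => by positivity) fun j _ => ?_
  have h0 := norm_sub_pos hη hz j
  calc ‖z - η j‖ ^ α j = ‖z - η j‖ ^ (α j - β j) * ‖z - η j‖ ^ β j := by
        rw [← Real.rpow_add h0]
        ring_nf
    _ ≤ 2 ^ (α j - β j) * ‖z - η j‖ ^ β j := by
        refine mul_le_mul_of_nonneg_right ?_ (by positivity)
        exact Real.rpow_le_rpow h0.le (norm_sub_le_two (mem_ball_zero_iff.1 hz) (hη j))
          (by linarith [h j])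

/-- At the origin every `|z - ηⱼ|` equals `1`, and the bound reads `1 ≤ exp D`. -/
theorem HasGrowthBound.nonneg {p D : ℝ} {f : ℂ → ℂ} (hη : ∀ j, ‖η j‖ = 1)
    (h : HasGrowthBound η q p D f) : 0 ≤ D := by
  have := h.bound 0 (mem_ball_self one_pos)
  rw [h.norm_zero, norm_ratProd] at this
  simpa [hη] using this

theorem HasGrowthBound.log_le {p D : ℝ} {f : ℂ → ℂ} (hη : ∀ j, ‖η j‖ = 1)
    (h : HasGrowthBound η q p D f) (hz : z ∈ ball (0 : ℂ) 1) :
    Real.log ‖f z‖ ≤ D * (1 / ((1 - ‖z‖ ^ 2) ^ p * normProd η q z)) := by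
  have hw := one_sub_sq_pos hz
  have hq := normProd_pos (α := q) hη hz
  have hb := h.bound z hz
  rw [norm_ratProd] at hb
  rw [mul_one_div]
  rcases eq_or_ne (f z) 0 with h0 | h0
  · rw [h0, _root_.norm_zero, Real.log_zero]
    exact div_nonneg (h.nonneg hη) (by positivity)
  · rw [Real.log_le_iff_le_exp (norm_pos_iff.2 h0)]
    exact hb

theorem one_sub_norm_pos (hz : z ∈ ball (0 : ℂ) 1) : 0 < 1 - ‖z‖ := by
  rw [mem_ball_zero_iff] at hz
  linarith

theorem one_sub_norm_le (hz : z ∈ ball (0 : ℂ) 1) : 1 - ‖z‖ ≤ 1 - ‖z‖ ^ 2 := by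
  rw [mem_ball_zero_iff] at hz
  nlinarith [norm_nonneg z]

/-- Taken with `θ = 0`. Since `αⱼ - qⱼ ≥ -1 + ε ≥ -(1 - 2 τ)`, the exponent `σ = 1 - τ` leaves a
spare factor `|z - ηⱼ| ^ (-τ)` at each point, and this absorbs the Poisson terms. -/
theorem zeros_sum_le_of_log_growth (hη : ∀ j, ‖η j‖ = 1) (hinj : Function.Injective η)
    {ε : ℝ} (hε : 0 < ε) : ∃ c : ℝ, ∀ (D : ℝ) (f : ℂ → ℂ), HasGrowthBound η q 0 D f →
      ZeroSumLE f
        (fun a => (1 - ‖a‖) * ‖ratProd η (fun j => max (q j - 1 + ε) 0) a‖) (D * c) := by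
  set α : Fin n → ℝ := fun j => max (q j - 1 + ε) 0 with hα
  have hα0 : ∀ j, 0 ≤ α j := fun j => le_max_right _ _
  set τ := min ε 1 / 2 with hτdef
  have hτ : 0 < τ := by
    have := lt_min hε one_pos
    positivity
  have hτ1 : τ ≤ 1 / 2 := by
    have := min_le_right ε 1
    rw [hτdef]
    linarith
  have hτε : 2 * τ ≤ ε := by
    have := min_le_left ε 1
    rw [hτdef]
    linarith
  set B₁ := ∏ j, (2 : ℝ) ^ ((α j - q j) - -(1 - 2 * τ)) with hB₁
  set B₂ := ∏ _j : Fin n, (2 : ℝ) ^ (0 - -τ) with hB₂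
  set B₃ : Fin n → ℝ := fun j => ∏ k, (2 : ℝ) ^ ((Pi.single j (-τ) : Fin n → ℝ) k - -τ) with hB₃
  have hB₁0 : 0 < B₁ := Finset.prod_pos fun j _ => by positivity
  have hB₂0 : 0 < B₂ := Finset.prod_pos fun j _ => by positivity
  have hB₃0 : ∀ j, 0 < B₃ j := fun j => Finset.prod_pos fun k _ => by positivity
  set B₄ := ∑ j, |α j| * (2 ^ (2 - τ) * B₃ j) with hB₄
  have hB₄0 : 0 ≤ B₄ := Finset.sum_nonneg fun j _ => by have := hB₃0 j; positivity
  have hsplit : ∀ z ∈ ball (0 : ℂ) 1, normProd η (fun _ => -(1 - 2 * τ)) z *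
      normProd η (fun _ => -τ) z = ∏ j, ‖z - η j‖ ^ (-(1 - τ)) := fun z hz => by
    rw [← normProd_add hη hz, normProd]
    refine Finset.prod_congr rfl fun j _ => ?_
    congr 1
    ring
  have hE : ∀ z ∈ ball (0 : ℂ) 1, 1 / ((1 - ‖z‖ ^ 2) ^ (0 : ℝ) * normProd η q z) *
      ((1 - ‖z‖ ^ 2) ^ (0 : ℝ) * Real.exp (logWeight η α z)) ≤
      B₁ * normProd η (fun _ => -(1 - 2 * τ)) z := fun z hz => by
    rw [exp_logWeight hη hz, Real.rpow_zero, one_mul, one_mul, one_div_mul_eq_div,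
      normProd_div hη hz]
    exact normProd_le hη hz fun j => by linarith [le_max_left (q j - 1 + ε) 0]
  have hone : ∀ z ∈ ball (0 : ℂ) 1, 1 ≤ B₂ * normProd η (fun _ => -τ) z := fun z hz => by
    have := normProd_le (α := fun _ => 0) (β := fun _ => -τ) hη hz fun j => by linarith
    rwa [show normProd η (fun _ => 0) z = 1 by simp [normProd]] at this
  obtain ⟨c, hc⟩ := exists_zero_sum_bound (α := α) (θ := 0) (σ := 1 - τ) (τ := τ) hη hinj le_rfl
    (fun j => by linarith [hα0 j]) (by linarith) (by linarith) hτ (by linarith)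
    (M := fun z => 1 / ((1 - ‖z‖ ^ 2) ^ (0 : ℝ) * normProd η q z)) (C₁ := B₁ * (B₂ + B₄))
    (fun z hz => by
      have := one_sub_sq_pos hz
      have := normProd_pos (α := q) hη hz
      positivity)
    (fun z hz => by
      have h0 := normProd_pos (α := fun _ => -(1 - 2 * τ)) hη hz
      have h1 := normProd_pos (α := fun _ => -τ) hη hz
      rw [← hsplit z hz]
      calc _ ≤ _ := hE z hz
        _ ≤ B₁ * normProd η (fun _ => -(1 - 2 * τ)) z *
            (B₂ * normProd η (fun _ => -τ) z) :=
            le_mul_of_one_le_right (by positivity) (hone z hz)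
        _ = B₁ * B₂ * (normProd η (fun _ => -(1 - 2 * τ)) z * normProd η (fun _ => -τ) z) := by
            ring
        _ ≤ _ := by gcongr; linarith)
    (fun z hz => by
      have hw := one_sub_sq_pos hz
      have h0 := normProd_pos (α := fun _ => -(1 - 2 * τ)) hη hz
      have h1 := normProd_pos (α := fun _ => -τ) hη hz
      have hw1 : 1 ≤ (1 - ‖z‖ ^ 2) ^ (τ - 1) :=
        Real.one_le_rpow_of_pos_of_le_one_of_nonpos hw (by linarith [sq_nonneg ‖z‖])
          (by linarith)
      have hS : poissonSum η α z ≤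
          B₄ * ((1 - ‖z‖ ^ 2) ^ (τ - 1) * normProd η (fun _ => -τ) z) := by
        rw [poissonSum, hB₄, Finset.sum_mul]
        refine Finset.sum_le_sum fun j _ => ?_
        rw [mul_assoc]
        refine mul_le_mul_of_nonneg_left ?_ (abs_nonneg _)
        have hj := norm_sub_pos hη hz j
        -- Trading `w ^ (2 - τ)` for `|z - ηⱼ| ^ (2 - τ)` bounds `w / |z - ηⱼ|²` by a multiple of `w
        -- ^ (τ - 1) |z - ηⱼ| ^ (-τ)`.
        have h2 : (1 - ‖z‖ ^ 2) ^ (2 - τ) ≤ 2 ^ (2 - τ) * ‖z - η j‖ ^ (2 - τ) := by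
          rw [← Real.mul_rpow zero_le_two hj.le]
          exact Real.rpow_le_rpow hw.le (one_sub_sq_le_two_mul hz (hη j)) (by linarith)
        have h3 : ‖z - η j‖ ^ (-τ) ≤ B₃ j * normProd η (fun _ => -τ) z := by
          have := normProd_le (α := Pi.single j (-τ)) (β := fun _ => -τ) hη hz fun k => by
            rcases eq_or_ne k j with rfl | hk
            · simp
            · simp [hk, hτ.le]
          refine le_trans (le_of_eq ?_) this
          rw [normProd, Finset.prod_eq_single j]
          · simp
          · intro k _ hk
            simp [hk]
          · simp
        calc (1 - ‖z‖ ^ 2) / ‖z - η j‖ ^ 2 =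
              (1 - ‖z‖ ^ 2) ^ (τ - 1) * (1 - ‖z‖ ^ 2) ^ (2 - τ) / ‖z - η j‖ ^ 2 := by
              rw [← Real.rpow_add hw, show τ - 1 + (2 - τ) = 1 by ring, Real.rpow_one]
          _ ≤ (1 - ‖z‖ ^ 2) ^ (τ - 1) * (2 ^ (2 - τ) * ‖z - η j‖ ^ (2 - τ)) / ‖z - η j‖ ^ 2 := by
              gcongr
          _ = (1 - ‖z‖ ^ 2) ^ (τ - 1) * 2 ^ (2 - τ) * ‖z - η j‖ ^ (-τ) := by
              rw [show -τ = (2 - τ) - (2 : ℕ) by push_cast; ring, Real.rpow_sub_natCast hj.ne']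
              ring
          _ ≤ (1 - ‖z‖ ^ 2) ^ (τ - 1) * 2 ^ (2 - τ) *
              (B₃ j * normProd η (fun _ => -τ) z) := by gcongr
          _ = _ := by ring
      have h4 : 1 + 0 / (1 - ‖z‖ ^ 2) + poissonSum η α z ≤
          (B₂ + B₄) * ((1 - ‖z‖ ^ 2) ^ (τ - 1) * normProd η (fun _ => -τ) z) := by
        have h5 : 1 ≤ B₂ * ((1 - ‖z‖ ^ 2) ^ (τ - 1) * normProd η (fun _ => -τ) z) := by
          have := one_le_mul_of_one_le_of_one_le (hone z hz) hw1
          linarith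
        rw [zero_div, add_zero, add_mul]
        linarith
      rw [← mul_assoc, ← hsplit z hz]
      have hS0 := poissonSum_nonneg (η := η) (α := α) hz
      calc _ ≤ B₁ * normProd η (fun _ => -(1 - 2 * τ)) z *
            ((B₂ + B₄) * ((1 - ‖z‖ ^ 2) ^ (τ - 1) * normProd η (fun _ => -τ) z)) :=
            mul_le_mul (hE z hz) h4 (by rw [zero_div]; linarith) (by positivity)
        _ = _ := by ring)
  refine ⟨c, fun D f hf => zeroSumLE_of_finset_bound
    (fun a ha => mul_nonneg (one_sub_norm_pos ha.1).le (norm_nonneg _)) fun A hA => ?_⟩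
  refine le_trans (Finset.sum_le_sum fun a ha => ?_) (hc D f (hf.nonneg hη) hf.holo hf.norm_zero
    (fun z hz => hf.log_le hη hz) A hA)
  have hz := (hA a ha).1
  rw [exp_logWeight hη hz, norm_ratProd, zero_add, Real.rpow_one]
  have := normProd_pos (α := α) hη hz
  exact mul_le_mul_of_nonneg_left (mul_le_mul_of_nonneg_right (one_sub_norm_le hz) this.le)
    (Nat.cast_nonneg _)

/-- Taken with `θ = p + (n + 1) τ`. The exponents `αⱼ - qⱼ` are only known to be at least `-1`,
which is borderline. The spare `w ^ (n τ)` is spent on raising each of the `n` exponents by `τ`; the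
last `w ^ τ` leaves `w ^ (τ - 1)` after division by `w`. -/
theorem zeros_sum_le_of_power_growth (hη : ∀ j, ‖η j‖ = 1) (hinj : Function.Injective η)
    {p : ℝ} (hp : 0 < p) {qt : Fin n → ℝ} (hqt : IsModifiedExponent p q qt) {ε : ℝ} (hε : 0 < ε) :
    ∃ c : ℝ, ∀ (D : ℝ) (f : ℂ → ℂ), HasGrowthBound η q p D f →
      ZeroSumLE f
        (fun a => (1 - ‖a‖) ^ (1 + p + ε) * ‖ratProd η (fun j => qt j - 1) a‖) (D * c) := by
  set α : Fin n → ℝ := fun j => qt j - 1 with hα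
  have hqtp : ∀ j, -(p / 2) ≤ α j ∧ q j ≤ qt j := fun j => by
    by_cases h : q j - 1 > -p / 2
    · rw [hα]
      simp only [(hqt j).1 h]
      constructor <;> linarith
    · have := (hqt j).2 h
      exact ⟨by simp only [hα]; linarith, by linarith⟩
  -- Small enough that `(n + 1) τ ≤ ε`, so `θ ≤ p + ε`, and that `τ ≤ 1`.
  set τ := min ε 1 / (n + 2) with hτdef
  have hm : 0 < min ε 1 := lt_min hε one_pos
  have hn0 : (0 : ℝ) ≤ n := Nat.cast_nonneg n
  have hτ : 0 < τ := by positivity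
  have hτmul : τ * (n + 2) = min ε 1 := by rw [hτdef]; field_simp
  have hτ1 : τ ≤ 1 := by nlinarith [min_le_right ε 1]
  have hτε : (n + 1) * τ ≤ ε := by nlinarith [min_le_left ε 1]
  set θ := p + (n + 1) * τ with hθdef
  have hθ : 0 ≤ θ := by positivity
  set B₁ := ∏ j, (2 : ℝ) ^ ((α j - q j) - (-1)) with hB₁
  set A₀ := ∑ j, |α j| with hA₀
  have hA₀0 : 0 ≤ A₀ := Finset.sum_nonneg fun j _ => abs_nonneg _
  have hB₁0 : 0 < B₁ := Finset.prod_pos fun j _ => by positivity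
  have hwτ : ∀ z ∈ ball (0 : ℂ) 1,
      (1 - ‖z‖ ^ 2) ^ (n * τ) ≤ 2 ^ (n * τ) * normProd η (fun _ => τ) z := fun z hz => by
    have hw := one_sub_sq_pos hz
    have h1 : ∏ _j : Fin n, (1 - ‖z‖ ^ 2) ^ τ ≤ ∏ j, (2 ^ τ * ‖z - η j‖ ^ τ) := by
      refine Finset.prod_le_prod (fun j _ => by positivity) fun j _ => ?_
      rw [← Real.mul_rpow zero_le_two (norm_nonneg _)]
      exact Real.rpow_le_rpow hw.le (one_sub_sq_le_two_mul hz (hη j)) hτ.le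
    rw [Finset.prod_mul_distrib] at h1
    have h2 : ∀ x : ℝ, 0 ≤ x → (x ^ τ) ^ n = x ^ (n * τ) := fun x hx => by
      rw [← Real.rpow_natCast, ← Real.rpow_mul hx, mul_comm]
    simp only [Finset.prod_const, Finset.card_univ, Fintype.card_fin, h2 _ hw.le,
      h2 2 zero_le_two] at h1
    exact h1
  have hE : ∀ z ∈ ball (0 : ℂ) 1, 1 / ((1 - ‖z‖ ^ 2) ^ p * normProd η q z) *
      ((1 - ‖z‖ ^ 2) ^ θ * Real.exp (logWeight η α z)) ≤
      B₁ * 2 ^ (n * τ) * ((1 - ‖z‖ ^ 2) ^ τ * ∏ j, ‖z - η j‖ ^ (-(1 - τ))) := fun z hz => by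
    have hw := one_sub_sq_pos hz
    have h0 := normProd_pos (α := fun _ => -1) hη hz
    have h1 : normProd η (fun j => α j - q j) z ≤ B₁ * normProd η (fun _ => -1) z :=
      normProd_le hη hz fun j => by simp only [hα]; linarith [(hqtp j).2]
    have h2 : normProd η (fun _ => τ) z * normProd η (fun _ => -1) z =
        ∏ j, ‖z - η j‖ ^ (-(1 - τ)) := by
      rw [← normProd_add hη hz, normProd]
      refine Finset.prod_congr rfl fun j _ => ?_
      congr 1
      ring
    have h3 : (1 - ‖z‖ ^ 2) ^ θ =
        (1 - ‖z‖ ^ 2) ^ p * ((1 - ‖z‖ ^ 2) ^ τ * (1 - ‖z‖ ^ 2) ^ (n * τ)) := by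
      rw [← Real.rpow_add hw, ← Real.rpow_add hw, hθdef]
      ring_nf
    have hwp : 0 < (1 - ‖z‖ ^ 2) ^ p := by positivity
    have hq := normProd_pos (α := q) hη hz
    rw [exp_logWeight hη hz]
    calc _ = (1 - ‖z‖ ^ 2) ^ τ * (1 - ‖z‖ ^ 2) ^ (n * τ) *
          (normProd η α z / normProd η q z) := by
          rw [h3]
          field_simp
      _ ≤ (1 - ‖z‖ ^ 2) ^ τ * (2 ^ (n * τ) * normProd η (fun _ => τ) z) *
          (B₁ * normProd η (fun _ => -1) z) := by
          rw [normProd_div hη hz]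
          have := normProd_pos (α := fun j => α j - q j) hη hz
          have := normProd_pos (α := fun _ => τ) hη hz
          have := hwτ z hz
          gcongr
      _ = _ := by rw [← h2]; ring
  obtain ⟨c, hc⟩ := exists_zero_sum_bound (α := α) (θ := θ) (σ := 1 - τ) (τ := τ) hη hinj hθ
    (fun j => by
      have h1 := (hqtp j).1
      have h2 : 0 ≤ (n + 1) * τ := by positivity
      rw [hθdef]
      linarith) (by linarith) (by linarith) hτ hτ1
    (M := fun z => 1 / ((1 - ‖z‖ ^ 2) ^ p * normProd η q z))
    (C₁ := B₁ * 2 ^ (n * τ) * (1 + θ + 4 * A₀))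
    (fun z hz => by
      have := one_sub_sq_pos hz
      have := normProd_pos (α := q) hη hz
      positivity)
    (fun z hz => by
      have hw := one_sub_sq_pos hz
      have hQ : 0 ≤ ∏ j, ‖z - η j‖ ^ (-(1 - τ)) := Finset.prod_nonneg fun j _ => by positivity
      have h1 : (1 - ‖z‖ ^ 2) ^ τ ≤ 1 :=
        Real.rpow_le_one hw.le (by linarith [sq_nonneg ‖z‖]) hτ.le
      refine (hE z hz).trans (mul_le_mul ?_ (mul_le_of_le_one_left hQ h1) (by positivity)
        (by positivity))
      exact le_mul_of_one_le_right (by positivity) (by linarith))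
    (fun z hz => by
      have hw := one_sub_sq_pos hz
      have hQ : 0 ≤ ∏ j, ‖z - η j‖ ^ (-(1 - τ)) := Finset.prod_nonneg fun j _ => by positivity
      have hS0 := poissonSum_nonneg (η := η) (α := α) hz
      -- Unlike in the case `p = 0`, the crude bound `4 / w` for each quotient is enough, as `θ / w`
      -- already has this size.
      have hS : poissonSum η α z ≤ 4 * A₀ / (1 - ‖z‖ ^ 2) := by
        rw [poissonSum, hA₀, Finset.mul_sum, Finset.sum_div]
        refine Finset.sum_le_sum fun j _ => ?_
        have hj := norm_sub_pos hη hz j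
        have h2 : (1 - ‖z‖ ^ 2) / ‖z - η j‖ ^ 2 ≤ 4 / (1 - ‖z‖ ^ 2) := by
          rw [div_le_div_iff₀ (by positivity) hw]
          nlinarith [one_sub_sq_le_two_mul hz (hη j)]
        calc _ ≤ |α j| * (4 / (1 - ‖z‖ ^ 2)) := mul_le_mul_of_nonneg_left h2 (abs_nonneg _)
          _ = _ := by ring
      have h4 : 1 + θ / (1 - ‖z‖ ^ 2) + poissonSum η α z ≤
          (1 + θ + 4 * A₀) / (1 - ‖z‖ ^ 2) := by
        have h5 : 1 ≤ 1 / (1 - ‖z‖ ^ 2) := by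
          rw [le_div_iff₀ hw]
          linarith [sq_nonneg ‖z‖]
        rw [add_div (1 + θ), add_div 1]
        linarith
      rw [← mul_assoc]
      calc _ ≤ B₁ * 2 ^ (n * τ) * ((1 - ‖z‖ ^ 2) ^ τ * ∏ j, ‖z - η j‖ ^ (-(1 - τ))) *
            ((1 + θ + 4 * A₀) / (1 - ‖z‖ ^ 2)) :=
            mul_le_mul (hE z hz) h4 (by positivity) (by positivity)
        _ = _ := by
            rw [Real.rpow_sub_one hw.ne']
            ring)
  refine ⟨c, fun D f hf => zeroSumLE_of_finset_bound
    (fun a ha => mul_nonneg (Real.rpow_nonneg (one_sub_norm_pos ha.1).le _) (norm_nonneg _))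
    fun A hA => ?_⟩
  refine le_trans (Finset.sum_le_sum fun a ha => ?_) (hc D f (hf.nonneg hη) hf.holo hf.norm_zero
    (fun z hz => hf.log_le hη hz) A hA)
  have hz := (hA a ha).1
  rw [exp_logWeight hη hz, norm_ratProd]
  have := normProd_pos (α := α) hη hz
  refine mul_le_mul_of_nonneg_left (mul_le_mul_of_nonneg_right ?_ this.le) (Nat.cast_nonneg _)
  have h1 := one_sub_norm_pos hz
  calc (1 - ‖a‖) ^ (1 + p + ε) ≤ (1 - ‖a‖) ^ (θ + 1) :=
        Real.rpow_le_rpow_of_exponent_ge h1 (by linarith [norm_nonneg a]) (by linarith)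
    _ ≤ (1 - ‖a‖ ^ 2) ^ (θ + 1) := Real.rpow_le_rpow h1.le (one_sub_norm_le hz) (by linarith)

end

theorem mainTheorem5 {n : ℕ} (η : Fin n → ℂ) (hη : ∀ j, ‖η j‖ = 1)
    (hinj : Function.Injective η) (q : Fin n → ℝ) :
    (∀ ε : ℝ, 0 < ε → ∃ c : ℝ, ∀ (D : ℝ) (f : ℂ → ℂ), HasGrowthBound η q 0 D f →
      ZeroSumLE f
        (fun a => (1 - ‖a‖) * ‖ratProd η (fun j => max (q j - 1 + ε) 0) a‖) (D * c)) ∧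
    (∀ p : ℝ, 0 < p → ∀ qt : Fin n → ℝ, IsModifiedExponent p q qt →
      ∀ ε : ℝ, 0 < ε → ∃ c : ℝ, ∀ (D : ℝ) (f : ℂ → ℂ), HasGrowthBound η q p D f →
        ZeroSumLE f
          (fun a => (1 - ‖a‖) ^ (1 + p + ε) * ‖ratProd η (fun j => qt j - 1) a‖) (D * c)) :=
  ⟨fun _ hε => zeros_sum_le_of_log_growth hη hinj hε,
    fun _ hp _ hqt _ hε => zeros_sum_le_of_power_growth hη hinj hp hqt hε⟩
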